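/- Let $R(x,y)=(x,-y)$, let $D\subset\mathbb R^2$ be open with $R(D)=D$, let $F=(F_1,F_2):D\to\mathbb R^2$ be of class $C^2$, and put $F^-=F$, $F^+=-R\circ F\circ R$. Let $\Gamma(t,z)$ be the local flow of $F$ in $D$ and $Y(t,z)=D_z\Gamma(t,z)$. Assume: $(h_1)$ there are $x_i<x_v$ such that $p_i=(x_i,0)$ and $p_v=(x_v,0)$ lie in $D$, $F_2(p_v)=F_2(p_i)=0$, $\frac{\partial F_2}{\partial x}(p_v)F_1(p_v)<0$, $\frac{\partial F_2}{\partial x}(p_i)F_1(p_i)>0$, and $F_2(x,0)\ne0$ for $x_i<x<x_v$; $(h_2)$ for each $x_i<x\le x_v$ the solution $\Gamma(t,(x,0))$ exists up to a time $\overline\sigma(x)>0$, satisfies $\Gamma_2(t,(x,0))<0$ for $0<t<\overline\sigma(x)$, and reaches $\Sigma=\{y=0\}$ transversely at $t=\overline\sigma(x)$, that is, $\Gamma_2(\overline\sigma(x),(x,0))=0$ and $F_2(\Gamma(\overline\sigma(x),(x,0)))\neq0$. Let $\varepsilon_0>0$, let $G^\pm(t,z)$ and $H^\pm(t,z;\varepsilon)$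 be $C^\infty$ functions with values in $\mathbb R^2$ on $\mathbb R\times D$ and $\mathbb R\times D\times(-\varepsilon_0,\varepsilon_0)$, and consider the Filippov system $$(x',y')=Z_\varepsilon(t,x,y)=X^\pm_\varepsilon(t,x,y)\ \text{ for } \pm y>0,\qquad X^\pm_\varepsilon(t,z)=F^\pm(z)+\varepsilon G^\pm(t,z)+\varepsilon^2H^\pm(t,z;\varepsilon).$$ For $\theta\in\mathbb R$ and $x\in(x_i,x_v]$ define the Melnikov function $$M(\theta,x)=F\big(\Gamma(\overline\sigma(x),(x,0))\big)\wedge\Big(Y(\overline\sigma(x),(x,0))\int_0^{\overline\sigma(x)}Y(t,(x,0))^{-1}\,\{G^-,G^+\}_\theta\big(t,\Gamma(t,(x,0))\big)\,dt\Big),$$ where $(a_1,a_2)\wedge(b_1,b_2)=-a_2b_1+a_1b_2$ and $\{G^-,G^+\}_\theta(t,z)=G^-(t+\theta,z)+R\,G^+(-t+\theta,Rz)$. Suppose that $Z_\varepsilon$ is autonomous for every $\varepsilon\in(-\varepsilon_0,\varepsilon_0)$; then $M(\theta,x)$ does not depend on $\theta$ and is denoted $M(x)$. If $x^*\in(x_i,x_v)$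 satisfies $M(x^*)=0$ and $M'(x^*)\neq0$, then there are $C>0$ and $\varepsilon_1\in(0,\varepsilon_0]$ such that for every $\varepsilon\in(0,\varepsilon_1)$ the system has a crossing periodic solution in $D$ whose initial condition is at distance at most $C\varepsilon$ from $(x^*,0)$. Here a crossing periodic solution is a periodic solution $u$ that follows $X^+_\varepsilon$ in $y>0$ and $X^-_\varepsilon$ in $y<0$, meets $\Sigma$, and meets it only at points of the crossing region, where the second components of $X^+_\varepsilon$ and $X^-_\varepsilon$ have the same nonzero sign and where $u$ passes from one zone to the other. -/

import Mathlib

/-!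
The reflection `R` turns the time-reversed upper system into another perturbation of the lower
field `F`. A crossing periodic orbit therefore corresponds to a point of `Σ` from which the orbits
of two perturbations of `F` through `y < 0` return to the same point of `Σ`: it runs along the first
one and comes back along the reflection of the second. The difference of the two half-return maps
vanishes at `ε = 0`, and by variation of constants its `ε`-derivative there is `-M(x) / F₂`, with
`F₂` evaluated at the landing point. Dividing the difference by `ε` and applying the intermediate
value theorem near a simple zero of `M` gives the orbits, at distance `O(ε)`. Flows are made global
by cutting the fields off away from the unperturbed half-orbit, and their smoothness in the initial
point comes from applying continuous dependence to the variational equation.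
-/

open Set
open scoped ContDiff

namespace TwoFold

/-- The involution `R(x, y) = (x, -y)` of the plane; its fixed set is the switching line `y = 0`. -/
def R (z : ℝ × ℝ) : ℝ × ℝ := (z.1, -z.2)

/-- The wedge product `(a₁, a₂) ∧ (b₁, b₂) = ⟨(-a₂, a₁), (b₁, b₂)⟩`. -/
def wedge (a b : ℝ × ℝ) : ℝ := -a.2 * b.1 + a.1 * b.2

/-- The field `F⁺(z) = -R F(R z)`; the field `F⁻` is `F` itself. -/
def reversed (F : ℝ × ℝ → ℝ × ℝ) (z : ℝ × ℝ) : ℝ × ℝ := -R (F (R z))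

/-- `u` solves `z' = F(z)` on the time set `J` and stays in the domain `D` of `F`. -/
def IsSolOn (F : ℝ × ℝ → ℝ × ℝ) (D : Set (ℝ × ℝ)) (J : Set ℝ) (u : ℝ → ℝ × ℝ) : Prop :=
  ∀ t ∈ J, u t ∈ D ∧ HasDerivWithinAt u (F (u t)) J t

/-- The solution of `w' = F(w)`, `w(0) = z`, exists in `D` at all times between `0` and `t`. -/
def InFlowDomain (F : ℝ × ℝ → ℝ × ℝ) (D : Set (ℝ × ℝ)) (t : ℝ) (z : ℝ × ℝ) : Prop :=
  ∃ u : ℝ → ℝ × ℝ, u 0 = z ∧ IsSolOn F D (uIcc 0 t) u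

open Classical in
/-- The local flow `Γ(t, z)` of `F` in `D`: the value at time `t` of the solution starting at `z`
(with the value `0` where that solution does not exist up to time `t`). -/
noncomputable def flow (F : ℝ × ℝ → ℝ × ℝ) (D : Set (ℝ × ℝ)) (t : ℝ) (z : ℝ × ℝ) : ℝ × ℝ :=
  if h : InFlowDomain F D t z then h.choose t else 0

/-- The fundamental matrix `Y(t, z) = D_z Γ(t, z)`. -/
noncomputable def fundamental (F : ℝ × ℝ → ℝ × ℝ) (D : Set (ℝ × ℝ)) (t : ℝ) (z : ℝ × ℝ) :
    ℝ × ℝ →L[ℝ] ℝ × ℝ :=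
  fderiv ℝ (fun w : ℝ × ℝ => flow F D t w) z

/-- Partial derivative `∂F₂/∂x` at `z`. -/
noncomputable def dxF2 (F : ℝ × ℝ → ℝ × ℝ) (z : ℝ × ℝ) : ℝ := (fderiv ℝ F z (1, 0)).2

/-- Hypothesis on the two folds: an invisible one at `(x_i, 0)`, a visible one at `(x_v, 0)`,
and no tangency in between. -/
structure FoldHyp (F : ℝ × ℝ → ℝ × ℝ) (D : Set (ℝ × ℝ)) (xi xv : ℝ) : Prop where
  lt : xi < xv
  mem_i : (xi, 0) ∈ D
  mem_v : (xv, 0) ∈ D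
  zero_v : (F (xv, 0)).2 = 0
  zero_i : (F (xi, 0)).2 = 0
  visible : dxF2 F (xv, 0) * (F (xv, 0)).1 < 0
  invisible : 0 < dxF2 F (xi, 0) * (F (xi, 0)).1
  ne_zero : ∀ x ∈ Ioo xi xv, (F (x, 0)).2 ≠ 0

/-- The solution of `z' = F(z)` from `(x, 0)` runs through `y < 0` for `0 < t < s` and reaches the
switching line transversely at time `s > 0`. -/
def ReachesAt (F : ℝ × ℝ → ℝ × ℝ) (D : Set (ℝ × ℝ)) (x s : ℝ) : Prop :=
  0 < s ∧ InFlowDomain F D s (x, 0) ∧ (∀ t ∈ Ioo 0 s, (flow F D t (x, 0)).2 < 0) ∧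
    (flow F D s (x, 0)).2 = 0 ∧ (F (flow F D s (x, 0))).2 ≠ 0

/-- Hypothesis on the return to the switching line. -/
def ReturnHyp (F : ℝ × ℝ → ℝ × ℝ) (D : Set (ℝ × ℝ)) (xi xv : ℝ) : Prop :=
  ∀ x ∈ Ioc xi xv, ∃ s : ℝ, ReachesAt F D x s

/-- The time `σ̄(x)` at which the solution from `(x, 0)` returns to the switching line. -/
noncomputable def returnTime (F : ℝ × ℝ → ℝ × ℝ) (D : Set (ℝ × ℝ)) (x : ℝ) : ℝ :=
  sInf {t : ℝ | 0 < t ∧ InFlowDomain F D t (x, 0) ∧ (flow F D t (x, 0)).2 = 0}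

/-- `{G⁻, G⁺}_θ(t, z) = G⁻(t + θ, z) + R G⁺(-t + θ, R z)`. -/
def bracket (Gm Gp : ℝ → ℝ × ℝ → ℝ × ℝ) (θ t : ℝ) (z : ℝ × ℝ) : ℝ × ℝ :=
  Gm (t + θ) z + R (Gp (-t + θ) (R z))

/-- The Melnikov function `M(θ, x)`. On `[0, σ̄(x)]` the unperturbed periodic orbit through
`(x, 0)` is `t ↦ Γ(t, (x, 0))`. -/
noncomputable def melnikov (F : ℝ × ℝ → ℝ × ℝ) (D : Set (ℝ × ℝ))
    (Gm Gp : ℝ → ℝ × ℝ → ℝ × ℝ) (θ x : ℝ) : ℝ :=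
  wedge (F (flow F D (returnTime F D x) (x, 0)))
    (fundamental F D (returnTime F D x) (x, 0)
      (∫ t in (0 : ℝ)..returnTime F D x,
        (fundamental F D t (x, 0)).inverse (bracket Gm Gp θ t (flow F D t (x, 0)))))

/-- The perturbed field `F(z) + ε G(t, z) + ε² H(t, z; ε)` of one zone. -/
def perturbed (F : ℝ × ℝ → ℝ × ℝ) (G : ℝ → ℝ × ℝ → ℝ × ℝ) (H : ℝ → ℝ × ℝ → ℝ → ℝ × ℝ)
    (ε t : ℝ) (z : ℝ × ℝ) : ℝ × ℝ :=
  F z + ε • G t z + ε ^ 2 • H t z ε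

/-- The system equal to `Xp` for `y > 0` and to `Xm` for `y < 0` does not depend on time. -/
def IsAutonomous (D : Set (ℝ × ℝ)) (Xp Xm : ℝ → ℝ × ℝ → ℝ × ℝ) : Prop :=
  ∀ s t : ℝ, ∀ z ∈ D, (0 < z.2 → Xp s z = Xp t z) ∧ (z.2 < 0 → Xm s z = Xm t z)

/-- `u` is a global solution in `D` of the Filippov system equal to `Xp` for `y > 0` and to `Xm`
for `y < 0`, and it meets the line `y = 0` only at points of the crossing region, where it passes
from one zone to the other. -/
structure IsCrossingSolution (D : Set (ℝ × ℝ)) (Xp Xm : ℝ → ℝ × ℝ → ℝ × ℝ)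
    (u : ℝ → ℝ × ℝ) : Prop where
  mem : ∀ t, u t ∈ D
  upper : ∀ t, 0 < (u t).2 → HasDerivAt u (Xp t (u t)) t
  lower : ∀ t, (u t).2 < 0 → HasDerivAt u (Xm t (u t)) t
  crossing : ∀ t, (u t).2 = 0 → 0 < (Xp t (u t)).2 * (Xm t (u t)).2
  cross_up : ∀ t, (u t).2 = 0 → 0 < (Xp t (u t)).2 →
    HasDerivWithinAt u (Xm t (u t)) (Iic t) t ∧ HasDerivWithinAt u (Xp t (u t)) (Ici t) t
  cross_down : ∀ t, (u t).2 = 0 → (Xp t (u t)).2 < 0 →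
    HasDerivWithinAt u (Xp t (u t)) (Iic t) t ∧ HasDerivWithinAt u (Xm t (u t)) (Ici t) t

/-- A crossing periodic solution: it is periodic and does meet the switching line. -/
def IsCrossingPeriodicSolution (D : Set (ℝ × ℝ)) (Xp Xm : ℝ → ℝ × ℝ → ℝ × ℝ)
    (u : ℝ → ℝ × ℝ) : Prop :=
  IsCrossingSolution D Xp Xm u ∧ (∃ T : ℝ, 0 < T ∧ Function.Periodic u T) ∧ ∃ t, (u t).2 = 0

end TwoFold

open Filter Topology Metric
open scoped NNReal

namespace TwoFold

section GlobalExistence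

variable {E : Type*} [NormedAddCommGroup E] [NormedSpace ℝ E]

theorem norm_le_gronwallBound_abs {u u' : ℝ → E} {K B T : ℝ}
    (hu : ∀ t ∈ Ioo (-T) T, HasDerivAt u (u' t) t)
    (hb : ∀ t ∈ Ioo (-T) T, ‖u' t‖ ≤ K * ‖u t‖ + B) {t : ℝ} (ht : t ∈ Ioo (-T) T) :
    ‖u t‖ ≤ gronwallBound ‖u 0‖ K B |t| := by
  have forward : ∀ v v' : ℝ → E, (∀ s ∈ Ioo (-T) T, HasDerivAt v (v' s) s) →
      (∀ s ∈ Ioo (-T) T, ‖v' s‖ ≤ K * ‖v s‖ + B) →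
      ∀ s ∈ Ico 0 T, ‖v s‖ ≤ gronwallBound ‖v 0‖ K B s := by
    intro v v' hv hvb s hs
    have hsub : Icc 0 s ⊆ Ioo (-T) T := fun r hr =>
      ⟨by linarith [hr.1, hs.1, hs.2], hr.2.trans_lt hs.2⟩
    simpa using norm_le_gronwallBound_of_norm_deriv_right_le
      (fun r hr => (hv r (hsub hr)).continuousAt.continuousWithinAt)
      (fun r hr => (hv r (hsub (Ico_subset_Icc_self hr))).hasDerivWithinAt) le_rfl
      (fun r hr => hvb r (hsub (Ico_subset_Icc_self hr))) s ⟨hs.1, le_rfl⟩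
  rcases le_total 0 t with h | h
  · simpa [abs_of_nonneg h] using forward u u' hu hb t ⟨h, ht.2⟩
  · have hneg : ∀ s ∈ Ioo (-T) T, -s ∈ Ioo (-T) T := fun s hs => ⟨neg_lt_neg hs.2, neg_lt.1 hs.1⟩
    simpa [abs_of_nonpos h] using forward (fun s => u (-s)) (fun s => -u' (-s))
      (fun s hs => by
        simpa [Function.comp_def] using (hu _ (hneg s hs)).scomp s (hasDerivAt_neg s))
      (fun s hs => by simpa using hb _ (hneg s hs)) (-t) ⟨neg_nonneg.2 h, neg_lt.1 ht.1⟩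

theorem exists_norm_le_mul_of_norm_deriv_le (K : ℝ≥0) (T : ℝ) :
    ∃ C > 0, ∀ (u u' : ℝ → E) (B : ℝ), u 0 = 0 → (∀ t ∈ Ioo (-T) T, HasDerivAt u (u' t) t) →
      (∀ t ∈ Ioo (-T) T, ‖u' t‖ ≤ K * ‖u t‖ + B) → ∀ t ∈ Ioo (-T) T, ‖u t‖ ≤ C * B := by
  have hmono : Monotone (gronwallBound 0 K 1) := gronwallBound_mono le_rfl zero_le_one K.2
  have hC : 0 ≤ gronwallBound 0 K 1 |T| := by simpa [gronwallBound_x0] using hmono (abs_nonneg T)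
  refine ⟨gronwallBound 0 K 1 |T| + 1, by positivity, fun u u' B h0 hu hb t ht => ?_⟩
  have hB : 0 ≤ B := by
    have hT : 0 < T := by linarith [ht.1, ht.2]
    simpa [h0] using (norm_nonneg _).trans (hb 0 ⟨neg_neg_of_pos hT, hT⟩)
  have hscale : gronwallBound 0 K B |t| = gronwallBound 0 K 1 |t| * B := by
    by_cases hK : (K : ℝ) = 0
    · simp [hK, gronwallBound_K0, mul_comm]
    · simp only [gronwallBound_of_K_ne_0 hK]; ring
  have hgronwall := norm_le_gronwallBound_abs hu hb ht
  rw [h0, norm_zero, hscale] at hgronwall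
  refine hgronwall.trans (mul_le_mul_of_nonneg_right ?_ hB)
  exact (hmono ((abs_lt.2 ht).le.trans (le_abs_self T))).trans (le_add_of_nonneg_right zero_le_one)

theorem exists_lipschitz_truncation [FiniteDimensional ℝ E] {N : ℝ} (hN : 0 < N) :
    ∃ (π : E → E) (K : ℝ≥0) (M : ℝ), LipschitzWith K π ∧ (∀ x, ‖x‖ ≤ N → π x = x) ∧
      (∀ x, ‖π x‖ ≤ ‖x‖) ∧ ∀ x, ‖π x‖ ≤ M := by
  let χ : ContDiffBump (0 : E) := ⟨N, N + 1, hN, lt_add_one N⟩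
  have hsupp : HasCompactSupport fun x : E => χ x • x := χ.hasCompactSupport.smul_right
  have hdiff : ContDiff ℝ 1 fun x : E => χ x • x := χ.contDiff.smul contDiff_id
  obtain ⟨K, hK⟩ := hdiff.lipschitzWith_of_hasCompactSupport hsupp one_ne_zero
  obtain ⟨M, hM⟩ := hsupp.exists_bound_of_continuous hdiff.continuous
  refine ⟨fun x => χ x • x, K, M, hK, fun x hx => ?_, fun x => ?_, hM⟩
  · simp [χ.one_of_mem_closedBall (mem_closedBall_zero_iff.2 hx)]
  · rw [norm_smul, Real.norm_of_nonneg χ.nonneg]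
    exact mul_le_of_le_one_left (norm_nonneg _) χ.le_one

theorem exists_solution_Ioo_of_bounded [CompleteSpace E] {f : ℝ → E → E} {K : ℝ≥0}
    (hf : ∀ t, LipschitzWith K (f t)) (hc : ∀ x, Continuous fun t => f t x) {T M : ℝ} (hT : 0 < T)
    (hM : ∀ t ∈ Icc (-T) T, ∀ x, ‖f t x‖ ≤ M) (x₀ : E) :
    ∃ u : ℝ → E, u 0 = x₀ ∧ ∀ t ∈ Ioo (-T) T, HasDerivAt u (f t (u t)) t := by
  have hM0 : 0 ≤ M := (norm_nonneg _).trans (hM 0 ⟨by linarith, hT.le⟩ 0)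
  let t₀ : Icc (-T) T := ⟨0, by linarith, hT.le⟩
  have hPL : IsPicardLindelof f t₀ x₀ (⟨M, hM0⟩ * ⟨T, hT.le⟩) 0 ⟨M, hM0⟩ K := by
    refine ⟨fun t _ => (hf t).lipschitzOnWith, fun x _ => (hc x).continuousOn,
      fun t ht x _ => hM t ht x, ?_⟩
    change M * max (T - 0) (0 - -T) ≤ M * T - 0
    simp
  obtain ⟨u, hu0, hu⟩ := hPL.exists_eq_forall_mem_Icc_hasDerivWithinAt₀
  exact ⟨u, hu0, fun t ht => (hu t (Ioo_subset_Icc_self ht)).hasDerivAt (Icc_mem_nhds ht.1 ht.2)⟩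

variable [FiniteDimensional ℝ E]

theorem exists_solution_Ioo {f : ℝ → E → E} {K : ℝ≥0} (hf : ∀ t, LipschitzWith K (f t))
    (hc : ∀ x, Continuous fun t => f t x) (x₀ : E) {T : ℝ} (hT : 0 < T) :
    ∃ u : ℝ → E, u 0 = x₀ ∧ ∀ t ∈ Ioo (-T) T, HasDerivAt u (f t (u t)) t := by
  have : CompleteSpace E := FiniteDimensional.complete ℝ E
  obtain ⟨B, hB⟩ := isCompact_Icc.exists_bound_of_continuousOn (s := Icc (-T) T) (hc 0).continuousOn
  have hB0 : 0 ≤ B := (norm_nonneg _).trans (hB 0 ⟨by linarith, hT.le⟩)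
  have hgrowth : ∀ t ∈ Icc (-T) T, ∀ x, ‖f t x‖ ≤ K * ‖x‖ + B := fun t ht x => by
    have hlip := (hf t).norm_sub_le x 0
    rw [sub_zero] at hlip
    linarith [norm_sub_norm_le (f t x) (f t 0), hB t ht]
  have hmono : Monotone (gronwallBound ‖x₀‖ K B) := gronwallBound_mono (norm_nonneg _) hB0 K.2
  -- The a priori bound for the solutions of both the original and the truncated equation.
  set N := gronwallBound ‖x₀‖ K B T + 1
  have hN : 0 < N := by
    have hN₀ := hmono hT.le
    rw [gronwallBound_x0] at hN₀
    linarith [norm_nonneg x₀]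
  obtain ⟨π, Kπ, M, hπ, hπ_eq, hπ_le, hπ_bdd⟩ := exists_lipschitz_truncation (E := E) hN
  obtain ⟨u, hu0, hu⟩ := exists_solution_Ioo_of_bounded (f := fun t x => f t (π x))
    (fun t => (hf t).comp hπ) (fun x => hc (π x)) hT
    (fun t ht x => (hgrowth t ht (π x)).trans
      (add_le_add_left (mul_le_mul_of_nonneg_left (hπ_bdd x) K.2) B)) x₀
  refine ⟨u, hu0, fun t ht => ?_⟩
  have hbound : ‖u t‖ ≤ gronwallBound ‖u 0‖ K B |t| := norm_le_gronwallBound_abs hu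
    (fun s hs => (hgrowth s (Ioo_subset_Icc_self hs) _).trans (by gcongr; exact hπ_le _)) ht
  have hle : ‖u t‖ ≤ N := by
    rw [hu0] at hbound
    exact hbound.trans ((hmono (abs_lt.2 ht).le).trans (le_add_of_nonneg_right zero_le_one))
  simpa only [hπ_eq _ hle] using hu t ht

theorem exists_global_solution {f : ℝ → E → E} {K : ℝ≥0} (hf : ∀ t, LipschitzWith K (f t))
    (hc : ∀ x, Continuous fun t => f t x) (x₀ : E) :
    ∃ u : ℝ → E, u 0 = x₀ ∧ ∀ t, HasDerivAt u (f t (u t)) t := by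
  have hpos : ∀ n : ℕ, (0 : ℝ) < n + 1 := fun n => by positivity
  choose u hu0 hu using fun n : ℕ => exists_solution_Ioo hf hc x₀ (hpos n)
  have hmono : ∀ m n : ℕ, m ≤ n → EqOn (u m) (u n) (Ioo (-(m + 1 : ℝ)) (m + 1)) := by
    intro m n hmn
    have hmn' : (m : ℝ) ≤ n := Nat.cast_le.2 hmn
    exact ODE_solution_unique_of_mem_Ioo (v := f) (s := fun _ => univ) (K := K) (t₀ := 0)
      (fun t _ => (hf t).lipschitzOnWith) ⟨by linarith [hpos m], hpos m⟩
      (fun t ht => ⟨hu m t ht, trivial⟩)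
      (fun t ht => ⟨hu n t ⟨by linarith [ht.1], by linarith [ht.2]⟩, trivial⟩)
      ((hu0 m).trans (hu0 n).symm)
  have hmem : ∀ t : ℝ, t ∈ Ioo (-((⌈|t|⌉₊ : ℝ) + 1)) (⌈|t|⌉₊ + 1) := fun t =>
    abs_lt.1 ((Nat.le_ceil |t|).trans_lt (lt_add_one _))
  have heq : ∀ n : ℕ, ∀ t ∈ Ioo (-(n + 1 : ℝ)) (n + 1), u ⌈|t|⌉₊ t = u n t := fun n t ht => by
    rcases le_total ⌈|t|⌉₊ n with h | h
    · exact hmono _ _ h (hmem t)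
    · exact (hmono _ _ h ht).symm
  refine ⟨fun t => u ⌈|t|⌉₊ t, hu0 _, fun t => (hu _ t (hmem t)).congr_of_eventuallyEq ?_⟩
  filter_upwards [Ioo_mem_nhds (hmem t).1 (hmem t).2] with s hs using heq _ s hs

end GlobalExistence

theorem continuous_uncurry_of_tendstoUniformlyOn {P G : Type*} [TopologicalSpace P]
    [UniformSpace G] {g : ℝ → P → G}
    (ht : ∀ p, Continuous fun t => g t p)
    (hp : ∀ T q, TendstoUniformlyOn (fun p t => g t p) (fun t => g t q) (𝓝 q) (Ioo (-T) T)) :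
    Continuous fun x : ℝ × P => g x.1 x.2 := by
  refine continuous_iff_continuousAt.2 fun x => ?_
  refine tendsto_comp_of_locally_uniform_limit (f := fun t => g t x.2) (F := fun y t => g t y.2)
    (ht x.2).continuousAt continuousAt_fst fun s hs => ?_
  refine ⟨Ioo (-(|x.1| + 1)) (|x.1| + 1), ?_, continuousAt_snd.eventually (hp _ x.2 s hs)⟩
  exact Ioo_mem_nhds (abs_lt.1 (lt_add_one |x.1|)).1 (abs_lt.1 (lt_add_one |x.1|)).2

section Flow

variable {E : Type*} [NormedAddCommGroup E] [NormedSpace ℝ E]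

/-- `Φ` is the global flow of the autonomous field `W`: the curve `t ↦ Φ t p` solves `z' = W z`
for all times and starts at `p`. -/
structure IsFlow (W : E → E) (Φ : ℝ → E → E) : Prop where
  zero : ∀ p, Φ 0 p = p
  hasDerivAt : ∀ t p, HasDerivAt (fun s => Φ s p) (W (Φ t p)) t

/-- `V` is the fundamental solution of the equation of first variation along the flow `Φ` of
`W`. -/
structure IsVariation (W : E → E) (Φ : ℝ → E → E) (V : ℝ → E → E →L[ℝ] E) : Prop where
  zero : ∀ p, V 0 p = ContinuousLinearMap.id ℝ E
  hasDerivAt : ∀ t p, HasDerivAt (fun s => V s p) ((fderiv ℝ W (Φ t p)).comp (V t p)) t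

variable {W : E → E} {Φ : ℝ → E → E} {V : ℝ → E → E →L[ℝ] E} {K : ℝ≥0}

theorem exists_isFlow [FiniteDimensional ℝ E] (hW : LipschitzWith K W) :
    ∃ Φ : ℝ → E → E, IsFlow W Φ := by
  choose Φ h0 h1 using exists_global_solution (f := fun _ => W) (fun _ => hW)
    (fun _ => continuous_const)
  exact ⟨fun t p => Φ p t, h0, fun t p => h1 p t⟩

theorem IsFlow.continuous_time (h : IsFlow W Φ) (p : E) : Continuous fun t => Φ t p :=
  continuous_iff_continuousAt.2 fun t => (h.hasDerivAt t p).continuousAt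

theorem IsVariation.continuous_time (hV : IsVariation W Φ V) (p : E) : Continuous fun t => V t p :=
  continuous_iff_continuousAt.2 fun t => (hV.hasDerivAt t p).continuousAt

theorem IsFlow.norm_sub_le (h : IsFlow W Φ) (hW : LipschitzWith K W) (t : ℝ) (p q : E) :
    ‖Φ t p - Φ t q‖ ≤ ‖p - q‖ * Real.exp (K * |t|) := by
  simpa [gronwallBound_ε0, h.zero] using
    norm_le_gronwallBound_abs (T := |t| + 1) (K := K) (B := 0)
      (fun s _ => (h.hasDerivAt s p).sub (h.hasDerivAt s q))
      (fun s _ => by simpa using hW.norm_sub_le (Φ s p) (Φ s q)) (abs_lt.1 (lt_add_one |t|))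

theorem IsVariation.norm_le (hV : IsVariation W Φ V) (hW : LipschitzWith K W) (t : ℝ) (p : E) :
    ‖V t p‖ ≤ Real.exp (K * |t|) := by
  have hgronwall := norm_le_gronwallBound_abs (K := K) (B := 0) (fun s _ => hV.hasDerivAt s p)
    (fun s _ => by
      rw [add_zero]
      refine (ContinuousLinearMap.opNorm_comp_le _ _).trans ?_
      gcongr
      exact norm_fderiv_le_of_lipschitz ℝ hW) (abs_lt.1 (lt_add_one |t|))
  rw [gronwallBound_ε0, hV.zero] at hgronwall
  exact hgronwall.trans
    (mul_le_of_le_one_left (Real.exp_pos _).le ContinuousLinearMap.norm_id_le)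

theorem IsFlow.tendstoUniformlyOn (h : IsFlow W Φ) (hW : LipschitzWith K W) (T : ℝ) (q : E) :
    TendstoUniformlyOn (fun p t => Φ t p) (fun t => Φ t q) (𝓝 q) (Ioo (-T) T) := by
  refine Metric.tendstoUniformlyOn_iff.2 fun η hη => ?_
  have hlim : Tendsto (fun p => ‖p - q‖ * Real.exp (K * T)) (𝓝 q) (𝓝 0) := by
    have : Continuous fun p => ‖p - q‖ * Real.exp (K * T) := by fun_prop
    simpa using this.tendsto q
  filter_upwards [hlim.eventually_lt_const hη] with p hp t ht
  rw [dist_comm, dist_eq_norm]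
  refine (h.norm_sub_le hW t p q).trans_lt (lt_of_le_of_lt ?_ hp)
  have := (abs_lt.2 ht).le
  gcongr

theorem IsFlow.continuous (h : IsFlow W Φ) (hW : LipschitzWith K W) :
    Continuous fun x : ℝ × E => Φ x.1 x.2 :=
  continuous_uncurry_of_tendstoUniformlyOn h.continuous_time (h.tendstoUniformlyOn hW)

theorem IsFlow.tendstoUniformlyOn_variation (h : IsFlow W Φ) (hV : IsVariation W Φ V)
    (hW : LipschitzWith K W) (hu : UniformContinuous (fderiv ℝ W)) (T : ℝ) (q : E) :
    TendstoUniformlyOn (fun p t => V t p) (fun t => V t q) (𝓝 q) (Ioo (-T) T) := by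
  obtain ⟨C, hC, hgronwall⟩ := exists_norm_le_mul_of_norm_deriv_le (E := E →L[ℝ] E) K T
  refine Metric.tendstoUniformlyOn_iff.2 fun η hη => ?_
  set c := C * Real.exp (K * T)
  have hA := hu.comp_tendstoUniformlyOn (h.tendstoUniformlyOn hW T q)
  filter_upwards [Metric.tendstoUniformlyOn_iff.1 hA (η / (2 * c)) (by positivity)] with p hp t ht
  rw [dist_comm, dist_eq_norm]
  refine (hgronwall (fun s => V s p - V s q) _ (η / (2 * c) * Real.exp (K * T)) (by simp [hV.zero])
    (fun s _ => (hV.hasDerivAt s p).sub (hV.hasDerivAt s q)) (fun s hs => ?_) t ht).trans_lt ?_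
  · have hsplit : (fderiv ℝ W (Φ s p)).comp (V s p) - (fderiv ℝ W (Φ s q)).comp (V s q)
        = (fderiv ℝ W (Φ s p)).comp (V s p - V s q)
          + (fderiv ℝ W (Φ s p) - fderiv ℝ W (Φ s q)).comp (V s q) := by
      ext v; simp
    have hs' := (abs_lt.2 hs).le
    rw [hsplit]
    refine (norm_add_le _ _).trans (add_le_add ?_ ?_) <;>
      refine (ContinuousLinearMap.opNorm_comp_le _ _).trans ?_ <;> gcongr
    · exact norm_fderiv_le_of_lipschitz ℝ hW
    · exact (dist_eq_norm _ _).symm.trans_le ((dist_comm _ _).trans_le (hp s hs).le)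
    · exact (hV.norm_le hW s q).trans (by gcongr)
  · calc C * (η / (2 * c) * Real.exp (K * T)) = η / 2 := by simp only [c]; field_simp
      _ < η := half_lt_self hη

theorem IsFlow.continuous_variation (h : IsFlow W Φ) (hV : IsVariation W Φ V)
    (hW : LipschitzWith K W) (hu : UniformContinuous (fderiv ℝ W)) :
    Continuous fun x : ℝ × E => V x.1 x.2 :=
  continuous_uncurry_of_tendstoUniformlyOn hV.continuous_time
    (h.tendstoUniformlyOn_variation hV hW hu)

theorem exists_norm_sub_sub_fderiv_le (hd : Differentiable ℝ W)
    (hu : UniformContinuous (fderiv ℝ W)) {η : ℝ} (hη : 0 < η) :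
    ∃ ρ > 0, ∀ a b, ‖a - b‖ < ρ → ‖W a - W b - fderiv ℝ W b (a - b)‖ ≤ η * ‖a - b‖ := by
  obtain ⟨ρ, hρ, hclose⟩ := Metric.uniformContinuous_iff.1 hu η hη
  refine ⟨ρ, hρ, fun a b hab => ?_⟩
  refine (convex_ball b ρ).norm_image_sub_le_of_norm_fderiv_le' (𝕜 := ℝ) (fun x _ => hd x)
    (fun x hx => ?_) (mem_ball_self hρ) (mem_ball_iff_norm.2 hab)
  exact (dist_eq_norm _ _).symm.trans_le (hclose hx).le

theorem IsFlow.hasFDerivAt (h : IsFlow W Φ) (hV : IsVariation W Φ V) (hW : LipschitzWith K W)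
    (hd : Differentiable ℝ W) (hu : UniformContinuous (fderiv ℝ W)) (t : ℝ) (q : E) :
    HasFDerivAt (Φ t) (V t q) q := by
  rw [hasFDerivAt_iff_isLittleO_nhds_zero, Asymptotics.isLittleO_iff]
  intro η hη
  set T := |t| + 1
  obtain ⟨C, hC, hgronwall⟩ := exists_norm_le_mul_of_norm_deriv_le (E := E) K T
  set c := C * Real.exp (K * T)
  obtain ⟨ρ, hρ, hlin⟩ := exists_norm_sub_sub_fderiv_le hd hu (η := η / c) (by positivity)
  have hnear : ∀ᶠ v : E in 𝓝 0, ‖v‖ * Real.exp (K * T) < ρ := by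
    have : Continuous fun v : E => ‖v‖ * Real.exp (K * T) := by fun_prop
    exact (this.tendsto 0).eventually_lt_const (by simpa using hρ)
  filter_upwards [hnear] with v hv
  have hΦ : ∀ s ∈ Ioo (-T) T, ‖Φ s (q + v) - Φ s q‖ ≤ ‖v‖ * Real.exp (K * T) := fun s hs => by
    have hs' := (abs_lt.2 hs).le
    refine (h.norm_sub_le hW s (q + v) q).trans ?_
    rw [add_sub_cancel_left]
    gcongr
  refine (hgronwall (fun s => Φ s (q + v) - Φ s q - V s q v) _ (η / c * (‖v‖ * Real.exp (K * T)))
    (by simp [hV.zero, h.zero])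
    (fun s _ => ((h.hasDerivAt s (q + v)).sub (h.hasDerivAt s q)).sub
      ((hV.hasDerivAt s q).clm_apply (hasDerivAt_const s v)))
    (fun s hs => ?_) t (abs_lt.1 (lt_add_one |t|))).trans (le_of_eq ?_)
  · have hsplit : W (Φ s (q + v)) - W (Φ s q) - (((fderiv ℝ W (Φ s q)).comp (V s q)) v + (V s q) 0)
        = fderiv ℝ W (Φ s q) (Φ s (q + v) - Φ s q - V s q v)
          + (W (Φ s (q + v)) - W (Φ s q) - fderiv ℝ W (Φ s q) (Φ s (q + v) - Φ s q)) := by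
      simp
    rw [hsplit]
    refine (norm_add_le _ _).trans (add_le_add ?_ ?_)
    · refine (ContinuousLinearMap.le_opNorm _ _).trans ?_
      gcongr
      exact norm_fderiv_le_of_lipschitz ℝ hW
    · refine (hlin _ _ ((hΦ s hs).trans_lt hv)).trans ?_
      gcongr
      exact hΦ s hs
  · simp only [c]; field_simp

theorem uniformContinuous_fderiv_of_hasCompactSupport (hW : ContDiff ℝ 1 W)
    (hs : HasCompactSupport W) : UniformContinuous (fderiv ℝ W) :=
  (hs.fderiv ℝ).uniformContinuous_of_continuous (hW.continuous_fderiv one_ne_zero)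

end Flow

section SmoothFlow

variable {E : Type*} [NormedAddCommGroup E] [NormedSpace ℝ E] [FiniteDimensional ℝ E]
  {W : E → E} {Φ : ℝ → E → E} {V : ℝ → E → E →L[ℝ] E}

theorem IsFlow.exists_isVariation {K : ℝ≥0} (h : IsFlow W Φ) (hW : LipschitzWith K W)
    (hc : Continuous (fderiv ℝ W)) : ∃ V : ℝ → E → E →L[ℝ] E, IsVariation W Φ V := by
  have hlip : ∀ p t, LipschitzWith K fun A : E →L[ℝ] E => (fderiv ℝ W (Φ t p)).comp A := by
    refine fun p t => LipschitzWith.of_dist_le_mul fun A B => ?_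
    rw [dist_eq_norm, dist_eq_norm, ← ContinuousLinearMap.comp_sub]
    refine (ContinuousLinearMap.opNorm_comp_le _ _).trans ?_
    gcongr
    exact norm_fderiv_le_of_lipschitz ℝ hW
  choose V h0 h1 using fun p => exists_global_solution (hlip p)
    (fun A => (hc.comp (h.continuous_time p)).clm_comp continuous_const)
    (ContinuousLinearMap.id ℝ E)
  exact ⟨fun t p => V p t, h0, fun t p => h1 p t⟩

theorem IsFlow.isVariation_fderiv (h : IsFlow W Φ) (hW : ContDiff ℝ 1 W)
    (hs : HasCompactSupport W) : IsVariation W Φ fun t p => fderiv ℝ (Φ t) p := by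
  obtain ⟨K, hK⟩ := hW.lipschitzWith_of_hasCompactSupport hs one_ne_zero
  obtain ⟨V, hV⟩ := h.exists_isVariation hK (hW.continuous_fderiv one_ne_zero)
  have hfderiv : (fun t p => fderiv ℝ (Φ t) p) = V := by
    ext1 t; ext1 p
    exact (h.hasFDerivAt hV hK (hW.differentiable one_ne_zero)
      (uniformContinuous_fderiv_of_hasCompactSupport hW hs) t p).fderiv
  rwa [hfderiv]

theorem IsFlow.contDiff_succ (h : IsFlow W Φ) (hV : IsVariation W Φ V) {n : ℕ}
    (hW : ContDiff ℝ (n + 1) W) (hs : HasCompactSupport W)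
    (hΦn : ContDiff ℝ n fun x : ℝ × E => Φ x.1 x.2)
    (hVn : ∀ v, ContDiff ℝ n fun x : ℝ × E => V x.1 x.2 v) :
    ContDiff ℝ (n + 1) fun x : ℝ × E => Φ x.1 x.2 := by
  have hW1 : ContDiff ℝ 1 W := hW.of_le le_add_self
  obtain ⟨K, hK⟩ := hW1.lipschitzWith_of_hasCompactSupport hs one_ne_zero
  have hu := uniformContinuous_fderiv_of_hasCompactSupport hW1 hs
  have hspan : Continuous fun x : ℝ × E =>
      ContinuousLinearMap.toSpanSingleton ℝ (W (Φ x.1 x.2)) := by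
    refine contDiff_zero.1 (contDiff_clm_apply_iff (𝕜 := ℝ).2 fun s => ?_)
    simp only [ContinuousLinearMap.toSpanSingleton_apply]
    exact contDiff_const.smul (contDiff_zero.2 (hW.continuous.comp (h.continuous hK)))
  rw [contDiff_succ_iff_hasFDerivAt]
  refine ⟨fun x => (ContinuousLinearMap.toSpanSingleton ℝ (W (Φ x.1 x.2))).coprod (V x.1 x.2),
    ?_, fun x => ?_⟩
  · rw [contDiff_clm_apply_iff]
    rintro ⟨s, v⟩
    simp only [ContinuousLinearMap.coprod_apply, ContinuousLinearMap.toSpanSingleton_apply]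
    exact (contDiff_const.smul ((hW.of_le le_self_add).comp hΦn)).add (hVn v)
  · exact (hasStrictFDerivAt_uncurry_coprod (f := Φ)
      (f₁ := fun t p => ContinuousLinearMap.toSpanSingleton ℝ (W (Φ t p))) (f₂ := V)
      (Eventually.of_forall fun v => (h.hasDerivAt v.1 v.2).hasFDerivAt)
      (Eventually.of_forall fun v =>
        h.hasFDerivAt hV hK (hW1.differentiable one_ne_zero) hu v.1 v.2)
      hspan.continuousAt (h.continuous_variation hV hK hu).continuousAt).hasFDerivAt

theorem exists_tangentField_truncation {n : ℕ} (hW : ContDiff ℝ (n + 1) W)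
    (hs : HasCompactSupport W) {N : ℝ} (hN : 0 < N) :
    ∃ W' : E × E → E × E, ContDiff ℝ n W' ∧ HasCompactSupport W' ∧
      ∀ p v, ‖v‖ ≤ N → W' (p, v) = (W p, fderiv ℝ W p v) := by
  let χ : ContDiffBump (0 : E) := ⟨N, N + 1, hN, lt_add_one N⟩
  refine ⟨fun x => χ x.2 • (W x.1, fderiv ℝ W x.1 x.2), ?_, ?_, fun p v hv => ?_⟩
  · refine (χ.contDiff.comp contDiff_snd).smul (ContDiff.prodMk ?_ ?_)
    · exact (hW.of_le le_self_add).comp contDiff_fst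
    · exact ((hW.fderiv_right le_rfl).comp contDiff_fst).clm_apply contDiff_snd
  · refine HasCompactSupport.intro (hs.isCompact.prod χ.hasCompactSupport.isCompact) ?_
    rintro ⟨p, w⟩ hpw
    rcases not_and_or.1 hpw with hp | hw
    · have hWp : W p = 0 := image_eq_zero_of_notMem_tsupport hp
      have hdWp : fderiv ℝ W p = 0 :=
        image_eq_zero_of_notMem_tsupport fun h => hp (tsupport_fderiv_subset ℝ h)
      simp [hWp, hdWp]
    · have hχw : χ w = 0 := image_eq_zero_of_notMem_tsupport hw
      simp [hχw]
  · simp [χ.one_of_mem_closedBall (mem_closedBall_zero_iff.2 hv)]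

-- `t ↦ (Φ t p, V t p v)` is an orbit of the tangent field `(p, v) ↦ (W p, DW(p) v)`, cut off
-- beyond the norms that `V t p v` can reach before time `T`.
theorem IsFlow.exists_tangentFlow (h : IsFlow W Φ) (hV : IsVariation W Φ V) {n : ℕ} (hn : n ≠ 0)
    (hW : ContDiff ℝ (n + 1) W) (hs : HasCompactSupport W) (v : E) {T : ℝ} (hT : 0 < T) :
    ∃ (W' : E × E → E × E) (Ψ : ℝ → E × E → E × E), ContDiff ℝ n W' ∧ HasCompactSupport W' ∧
      IsFlow W' Ψ ∧ ∀ p, ∀ t ∈ Ioo (-T) T, (Φ t p, V t p v) = Ψ t (p, v) := by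
  obtain ⟨K, hK⟩ := hW.lipschitzWith_of_hasCompactSupport hs (by positivity)
  have hVv : ∀ p, ∀ t ∈ Ioo (-T) T, ‖V t p v‖ ≤ Real.exp (K * T) * ‖v‖ + 1 := fun p t ht => by
    have ht' := (abs_lt.2 ht).le
    refine ((V t p).le_of_opNorm_le ((hV.norm_le hK t p).trans ?_) v).trans
      (le_add_of_nonneg_right zero_le_one)
    gcongr
  obtain ⟨W', hW', hs', heq⟩ := exists_tangentField_truncation hW hs
    (N := Real.exp (K * T) * ‖v‖ + 1) (by positivity)
  obtain ⟨K', hK'⟩ := hW'.lipschitzWith_of_hasCompactSupport hs' (by exact_mod_cast hn)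
  obtain ⟨Ψ, hΨ⟩ := exists_isFlow hK'
  refine ⟨W', Ψ, hW', hs', hΨ, fun p => ?_⟩
  refine ODE_solution_unique_of_mem_Ioo (v := fun _ => W') (s := fun _ => univ) (K := K')
    (t₀ := 0) (fun t _ => hK'.lipschitzOnWith) ⟨neg_lt_zero.2 hT, hT⟩ (fun t ht => ⟨?_, trivial⟩)
    (fun t _ => ⟨hΨ.hasDerivAt t _, trivial⟩) (by simp [hV.zero, h.zero, hΨ.zero])
  rw [heq _ _ (hVv p t ht)]
  have hVd := (hV.hasDerivAt t p).clm_apply (hasDerivAt_const t v)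
  simp only [map_zero, add_zero, ContinuousLinearMap.comp_apply] at hVd
  exact (h.hasDerivAt t p).prodMk hVd

theorem IsFlow.contDiff_variation_of_tangentFlow (h : IsFlow W Φ) (hV : IsVariation W Φ V) {n : ℕ}
    (hn : n ≠ 0) (hW : ContDiff ℝ (n + 1) W) (hs : HasCompactSupport W)
    (hΨ : ∀ (W' : E × E → E × E) (Ψ : ℝ → E × E → E × E), IsFlow W' Ψ → ContDiff ℝ n W' →
      HasCompactSupport W' → ContDiff ℝ n fun x : ℝ × E × E => Ψ x.1 x.2) (v : E) :
    ContDiff ℝ n fun x : ℝ × E => V x.1 x.2 v := by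
  refine contDiff_iff_contDiffAt.2 fun x₀ => ?_
  have hT : 0 < |x₀.1| + 1 := by positivity
  obtain ⟨W', Ψ, hW', hs', hΨ', heq⟩ := h.exists_tangentFlow hV hn hW hs v hT
  have hsmooth : ContDiff ℝ n fun x : ℝ × E => (Ψ x.1 (x.2, v)).2 :=
    contDiff_snd.comp ((hΨ W' Ψ hΨ' hW' hs').comp
      (contDiff_fst.prodMk (contDiff_snd.prodMk contDiff_const)))
  refine hsmooth.contDiffAt.congr_of_eventuallyEq ?_
  have hx₀ := abs_lt.1 (lt_add_one |x₀.1|)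
  filter_upwards [continuousAt_fst.eventually (Ioo_mem_nhds hx₀.1 hx₀.2)] with x hx
  rw [← heq x.2 x.1 hx]

end SmoothFlow

theorem IsFlow.contDiff {E : Type*} [NormedAddCommGroup E] [NormedSpace ℝ E]
    [FiniteDimensional ℝ E] {W : E → E} {Φ : ℝ → E → E} (h : IsFlow W Φ) {n : ℕ} (hn : n ≠ 0)
    (hW : ContDiff ℝ n W) (hs : HasCompactSupport W) :
    ContDiff ℝ n fun x : ℝ × E => Φ x.1 x.2 := by
  obtain ⟨n, rfl⟩ := Nat.exists_eq_succ_of_ne_zero hn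
  induction n generalizing E with
  | zero =>
    have hW1 : ContDiff ℝ 1 W := by simpa using hW
    obtain ⟨K, hK⟩ := hW1.lipschitzWith_of_hasCompactSupport hs one_ne_zero
    have hV := h.isVariation_fderiv hW1 hs
    have hVc := h.continuous_variation hV hK (uniformContinuous_fderiv_of_hasCompactSupport hW1 hs)
    exact_mod_cast h.contDiff_succ hV (n := 0) (by exact_mod_cast hW) hs
      (contDiff_zero.2 (h.continuous hK))
      fun v => contDiff_zero.2 (hVc.clm_apply continuous_const)
  | succ n ih =>
    have hW₁ : ContDiff ℝ 1 W := hW.of_le (by exact_mod_cast Nat.succ_le_succ n.succ.zero_le)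
    have hV := h.isVariation_fderiv hW₁ hs
    have hW' : ContDiff ℝ ((n + 1 : ℕ) + 1) W := by exact_mod_cast hW
    exact_mod_cast h.contDiff_succ hV hW' hs (ih h hs n.succ_ne_zero (hW'.of_le le_self_add))
      (h.contDiff_variation_of_tangentFlow hV n.succ_ne_zero hW' hs
        fun W' Ψ hΨ hW' hs' => ih hΨ hs' n.succ_ne_zero hW')

theorem exists_contDiff_hasCompactSupport_eqOn {E G : Type*} [NormedAddCommGroup E]
    [NormedSpace ℝ E] [FiniteDimensional ℝ E] [NormedAddCommGroup G] [NormedSpace ℝ G] {n : ℕ∞}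
    {f : E → G} {O K : Set E} (hO : IsOpen O) (hf : ContDiffOn ℝ n f O) (hK : IsCompact K)
    (hKO : K ⊆ O) :
    ∃ (g : E → G) (N : Set E), ContDiff ℝ n g ∧ HasCompactSupport g ∧ EqOn g f N ∧
      IsOpen N ∧ K ⊆ N ∧ N ⊆ O := by
  obtain ⟨K', hK', hKK', hK'O⟩ := exists_compact_between hK hO hKO
  obtain ⟨χ, hχ1, hχ0, -⟩ := exists_contMDiffMap_one_nhds_of_subset_interior (n := n)
    (modelWithCornersSelf ℝ E) hK.isClosed hKK'
  obtain ⟨N, hN, hKN, hNχ⟩ := mem_nhdsSet_iff_exists.1 hχ1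
  have hsupp : tsupport χ ⊆ K' :=
    closure_minimal (Function.support_subset_iff'.2 hχ0) hK'.isClosed
  refine ⟨fun p => χ p • f p, N, ?_, ?_, fun p hp => by simp [show χ p = 1 from hNχ hp], hN, hKN,
    fun p hp => ?_⟩
  · refine contDiff_iff_contDiffAt.2 fun p => ?_
    by_cases hp : p ∈ O
    · exact χ.contMDiff.contDiff.contDiffAt.smul (hf.contDiffAt (hO.mem_nhds hp))
    · have hp' : p ∉ tsupport χ := fun h => hp (hK'O (hsupp h))
      refine (contDiffAt_const (c := (0 : G))).congr_of_eventuallyEq ?_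
      filter_upwards [(isClosed_tsupport χ).isOpen_compl.mem_nhds hp'] with x hx
      simp [image_eq_zero_of_notMem_tsupport hx]
  · exact HasCompactSupport.intro hK' fun x hx => by simp [hχ0 x hx]
  · by_contra hpO
    have hp1 : χ p = 1 := hNχ hp
    exact one_ne_zero (hp1.symm.trans (hχ0 p fun h => hpO (hK'O h)))

section ParameterDependence

variable {E Q : Type*} [NormedAddCommGroup E] [NormedSpace ℝ E] [NormedAddCommGroup Q]
  [NormedSpace ℝ Q]

/-- `φ` is a local flow, of class `C^n` in all variables, of the field `X(·, q)` depending on a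
parameter `q`: as long as `(φ t (z, q), q)` lies in the open set `N`, the curve `t ↦ φ t (z, q)`
solves `w' = X (w, q)` and its derivative in `(z, q)` solves the equation of first variation.
Outside `N` the values of `φ` carry no information, so that `φ` can be defined for all times. -/
structure IsLocalParamFlow (n : WithTop ℕ∞) (X : E × Q → E) (N : Set (E × Q))
    (φ : ℝ → E × Q → E) : Prop where
  isOpen : IsOpen N
  contDiffOn_field : ContDiffOn ℝ n X N
  contDiff : ContDiff ℝ n fun x : ℝ × E × Q => φ x.1 x.2
  zero : ∀ p, φ 0 p = p.1
  hasDerivAt : ∀ t p, (φ t p, p.2) ∈ N → HasDerivAt (fun s => φ s p) (X (φ t p, p.2)) t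
  hasDerivAt_fderiv : ∀ t p, (φ t p, p.2) ∈ N → HasDerivAt (fun s => fderiv ℝ (φ s) p)
    ((fderiv ℝ X (φ t p, p.2)).comp
      ((fderiv ℝ (φ t) p).prod (ContinuousLinearMap.snd ℝ E Q))) t

theorem IsLocalParamFlow.congr {n : WithTop ℕ∞} {X Y : E × Q → E} {N N' : Set (E × Q)}
    {φ : ℝ → E × Q → E} (h : IsLocalParamFlow n X N φ) (hN' : IsOpen N') (hsub : N' ⊆ N)
    (heq : EqOn X Y N') : IsLocalParamFlow n Y N' φ where
  isOpen := hN'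
  contDiffOn_field := (h.contDiffOn_field.mono hsub).congr heq.symm
  contDiff := h.contDiff
  zero := h.zero
  hasDerivAt t p hp := heq hp ▸ h.hasDerivAt t p (hsub hp)
  hasDerivAt_fderiv t p hp := by
    rw [← (heq.eventuallyEq_of_mem (hN'.mem_nhds hp)).fderiv_eq]
    exact h.hasDerivAt_fderiv t p (hsub hp)

theorem IsFlow.snd_eq {W : E × Q → E × Q} {Φ : ℝ → E × Q → E × Q} (h : IsFlow W Φ)
    (hW : ∀ p, (W p).2 = 0) (t : ℝ) (p : E × Q) : (Φ t p).2 = p.2 := by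
  have hderiv : ∀ s, HasDerivAt (fun s => (Φ s p).2) 0 s := fun s =>
    (hasFDerivAt_snd.comp_hasDerivAt s (h.hasDerivAt s p)).congr_deriv (hW (Φ s p))
  simpa [h.zero] using is_const_of_deriv_eq_zero (fun s => (hderiv s).differentiableAt)
    (fun s => (hderiv s).deriv) t 0

variable [FiniteDimensional ℝ E] [FiniteDimensional ℝ Q] {n : ℕ}

theorem exists_isLocalParamFlow_univ {X : E × Q → E} (hn : n ≠ 0) (hX : ContDiff ℝ n X)
    (hs : HasCompactSupport X) : ∃ φ, IsLocalParamFlow n X univ φ := by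
  have hW : ContDiff ℝ n fun p => (X p, (0 : Q)) := hX.prodMk contDiff_const
  have hWs : HasCompactSupport fun p => (X p, (0 : Q)) :=
    hs.comp_left (g := fun z => (z, (0 : Q))) rfl
  have hW1 : ContDiff ℝ 1 fun p => (X p, (0 : Q)) :=
    hW.of_le (by exact_mod_cast Nat.one_le_iff_ne_zero.2 hn)
  obtain ⟨K, hK⟩ := hW1.lipschitzWith_of_hasCompactSupport hWs one_ne_zero
  obtain ⟨Φ, hΦ⟩ := exists_isFlow hK
  have hsmooth := hΦ.contDiff hn hW hWs
  have hV := hΦ.isVariation_fderiv hW1 hWs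
  have hsnd : ∀ t p, (Φ t p).2 = p.2 := hΦ.snd_eq fun _ => rfl
  have hpair : ∀ t p, ((Φ t p).1, p.2) = Φ t p := fun t p => by rw [← hsnd t p]
  have hdiff : ∀ t, Differentiable ℝ (Φ t) := fun t =>
    (hsmooth.comp (contDiff_const.prodMk contDiff_id)).differentiable (by exact_mod_cast hn)
  have hfst : ∀ t p, fderiv ℝ (fun w => (Φ t w).1) p =
      (ContinuousLinearMap.fst ℝ E Q).comp (fderiv ℝ (Φ t) p) := fun t p =>
    fderiv.fst (hdiff t p)
  have hprod : ∀ t p, (fderiv ℝ (fun w => (Φ t w).1) p).prod (ContinuousLinearMap.snd ℝ E Q) =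
      fderiv ℝ (Φ t) p := fun t p => by
    have hΦeq : Φ t = fun w => ((Φ t w).1, w.2) := funext fun w => (hpair t w).symm
    conv_rhs => rw [hΦeq]
    exact (HasFDerivAt.prodMk ((hdiff t p).fst.hasFDerivAt) hasFDerivAt_snd).fderiv.symm
  refine ⟨fun t p => (Φ t p).1, isOpen_univ, hX.contDiffOn,
    contDiff_fst.comp hsmooth, fun p => by rw [hΦ.zero], fun t p _ => ?_, fun t p _ => ?_⟩
  · rw [hpair]
    exact hasFDerivAt_fst.comp_hasDerivAt t (hΦ.hasDerivAt t p)
  · have hderiv := (hasDerivAt_const t (ContinuousLinearMap.fst ℝ E Q)).clm_comp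
      (hV.hasDerivAt t p)
    have hXd : DifferentiableAt ℝ X (Φ t p) := hX.differentiable (by exact_mod_cast hn) _
    rw [(hXd.hasFDerivAt.prodMk (hasFDerivAt_const (0 : Q) (Φ t p))).fderiv] at hderiv
    simp only [hprod, hpair]
    simp only [hfst]
    exact hderiv.congr_deriv (ContinuousLinearMap.ext fun v => by simp)

theorem exists_isLocalParamFlow {X : E × Q → E} {O : Set (E × Q)} (hn : n ≠ 0) (hO : IsOpen O)
    (hX : ContDiffOn ℝ n X O) {u : ℝ → E} {q : Q} {T : ℝ} (hmem : ∀ t ∈ Icc 0 T, (u t, q) ∈ O)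
    (hu : ∀ t ∈ Icc 0 T, HasDerivWithinAt u (X (u t, q)) (Icc 0 T) t) :
    ∃ N φ, IsLocalParamFlow n X N φ ∧ N ⊆ O ∧
      ∀ t ∈ Icc 0 T, (u t, q) ∈ N ∧ φ t (u 0, q) = u t := by
  have huc : ContinuousOn u (Icc 0 T) := fun t ht => (hu t ht).continuousWithinAt
  obtain ⟨X', N, hX', hs, heq, hN, hKN, hNO⟩ := exists_contDiff_hasCompactSupport_eqOn
    (n := n) hO hX (isCompact_Icc.image_of_continuousOn (huc.prodMk continuousOn_const))
    (image_subset_iff.2 hmem)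
  have huN : ∀ t ∈ Icc 0 T, (u t, q) ∈ N := fun t ht => hKN ⟨t, ht, rfl⟩
  obtain ⟨φ, hφ⟩ := exists_isLocalParamFlow_univ hn hX' hs
  obtain ⟨K, hK⟩ := hX'.lipschitzWith_of_hasCompactSupport hs (by exact_mod_cast hn)
  have hunique : EqOn (fun t => φ t (u 0, q)) u (Icc 0 T) :=
    ODE_solution_unique (v := fun _ z => X' (z, q)) (K := K * 1)
      (fun _ => hK.comp (LipschitzWith.prodMk_right q))
      (fun t _ => (hφ.hasDerivAt t _ trivial).continuousAt.continuousWithinAt)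
      (fun t _ => (hφ.hasDerivAt t _ trivial).hasDerivWithinAt) huc
      (fun t ht => by
        rw [heq (huN t (Ico_subset_Icc_self ht))]
        exact (hu t (Ico_subset_Icc_self ht)).mono_of_mem_nhdsWithin (Icc_mem_nhdsGE_of_mem ht))
      (hφ.zero _)
  exact ⟨N, φ, hφ.congr hN (subset_univ N) heq, hNO, fun t ht => ⟨huN t ht, hunique ht⟩⟩

end ParameterDependence

section VariationOfConstants

variable {E : Type*} [NormedAddCommGroup E] [NormedSpace ℝ E] {a b : ℝ}
  {A B : ℝ → E →L[ℝ] E}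

theorem eq_zero_of_fundamentalMatrix_apply_eq_zero (hB : ContinuousOn B (Icc a b))
    (hA : ∀ t ∈ Icc a b, HasDerivWithinAt A ((B t).comp (A t)) (Icc a b) t)
    (hAa : A a = ContinuousLinearMap.id ℝ E) {t : ℝ} (ht : t ∈ Icc a b) {v : E}
    (hv : A t v = 0) : v = 0 := by
  obtain ⟨K, hK⟩ := isCompact_Icc.exists_bound_of_continuousOn hB
  have hsub : Icc a t ⊆ Icc a b := Icc_subset_Icc_right ht.2
  have hderiv : ∀ s ∈ Icc a t, HasDerivWithinAt (fun s => A s v) (B s (A s v)) (Icc a t) s :=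
    fun s hs => by
      simpa using ((hA s (hsub hs)).mono hsub).clm_apply (hasDerivWithinAt_const s _ v)
  have hzero : EqOn (fun s => A s v) (fun _ => 0) (Icc a t) :=
    ODE_solution_unique_of_mem_Icc_left (v := fun s w => B s w) (s := fun _ => univ)
      (K := K.toNNReal)
      (fun s hs => ((B s).lipschitz.weaken (NNReal.le_toNNReal_of_coe_le
        (hK s (hsub (Ioc_subset_Icc_self hs))))).lipschitzOnWith)
      (fun s hs => (hderiv s hs).continuousWithinAt)
      (fun s hs => (hderiv s (Ioc_subset_Icc_self hs)).mono_of_mem_nhdsWithin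
        (Icc_mem_nhdsLE_of_mem hs))
      (fun _ _ => trivial) continuousOn_const
      (fun s _ => by simpa using hasDerivWithinAt_const s _ (0 : E)) (fun _ _ => trivial) hv
  simpa [hAa] using hzero ⟨le_rfl, ht.1⟩

variable [FiniteDimensional ℝ E]

theorem isInvertible_fundamentalMatrix (hB : ContinuousOn B (Icc a b))
    (hA : ∀ t ∈ Icc a b, HasDerivWithinAt A ((B t).comp (A t)) (Icc a b) t)
    (hAa : A a = ContinuousLinearMap.id ℝ E) {t : ℝ} (ht : t ∈ Icc a b) :
    (A t).IsInvertible := by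
  have hinj : Function.Injective (A t : E →ₗ[ℝ] E) :=
    (injective_iff_map_eq_zero _).2 fun _ hv =>
      eq_zero_of_fundamentalMatrix_apply_eq_zero hB hA hAa ht hv
  exact ⟨(LinearEquiv.ofInjectiveEndo _ hinj).toContinuousLinearEquiv, rfl⟩

theorem continuousOn_inverse_fundamentalMatrix (hB : ContinuousOn B (Icc a b))
    (hA : ∀ t ∈ Icc a b, HasDerivWithinAt A ((B t).comp (A t)) (Icc a b) t)
    (hAa : A a = ContinuousLinearMap.id ℝ E) :
    ContinuousOn (fun t => (A t).inverse) (Icc a b) := fun t ht =>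
  have := FiniteDimensional.complete ℝ E
  ((isInvertible_fundamentalMatrix hB hA hAa ht).contDiffAt_map_inverse
    (n := 0)).continuousAt.comp_continuousWithinAt (hA t ht).continuousWithinAt

theorem eq_fundamentalMatrix_apply_integral {w g : ℝ → E} (hab : a ≤ b)
    (hB : ContinuousOn B (Icc a b)) (hg : ContinuousOn g (Icc a b))
    (hA : ∀ t ∈ Icc a b, HasDerivWithinAt A ((B t).comp (A t)) (Icc a b) t)
    (hAa : A a = ContinuousLinearMap.id ℝ E)
    (hw : ∀ t ∈ Icc a b, HasDerivWithinAt w (B t (w t) + g t) (Icc a b) t) (hwa : w a = 0) :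
    w b = A b (∫ t in a..b, (A t).inverse (g t)) := by
  have := FiniteDimensional.complete ℝ E
  have hinv := fun {t} (ht : t ∈ Icc a b) => isInvertible_fundamentalMatrix hB hA hAa ht
  have hinvc := continuousOn_inverse_fundamentalMatrix hB hA hAa
  set c : ℝ → E := fun t => (A t).inverse (w t)
  have hAc : ∀ t ∈ Icc a b, A t (c t) = w t := fun t ht => (hinv ht).self_apply_inverse _
  have hc : ∀ t ∈ Ioo a b, HasDerivAt c ((A t).inverse (g t)) t := by
    intro t ht
    have ht' := Ioo_subset_Icc_self ht
    have hnhds := Icc_mem_nhds ht.1 ht.2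
    have hAt := (hA t ht').hasDerivAt hnhds
    have hwt := (hw t ht').hasDerivAt hnhds
    have hct : HasDerivAt c (deriv c t) t :=
      (((hinv ht').contDiffAt_map_inverse (n := 1)).differentiableAt one_ne_zero |>.comp t
        hAt.differentiableAt |>.clm_apply hwt.differentiableAt).hasDerivAt
    have hprod : HasDerivAt w (B t (w t) + A t (deriv c t)) t :=
      ((hAt.clm_apply hct).congr_of_eventuallyEq (by
        filter_upwards [hnhds] with s hs using (hAc s hs).symm)).congr_deriv (by simp [hAc t ht'])
    rwa [← add_left_cancel (hprod.unique hwt), (hinv ht').inverse_apply_self]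
  rw [intervalIntegral.integral_eq_sub_of_hasDeriv_right_of_le hab
    (hinvc.clm_apply fun t ht => (hw t ht).continuousWithinAt)
    (fun t ht => (hc t ht).hasDerivWithinAt)
    ((hinvc.clm_apply hg).intervalIntegrable_of_Icc hab)]
  simp [hwa, (hinv (right_mem_Icc.2 hab)).self_apply_inverse]

end VariationOfConstants

namespace IsLocalParamFlow

variable {E Q : Type*} [NormedAddCommGroup E] [NormedSpace ℝ E] [NormedAddCommGroup Q]
  [NormedSpace ℝ Q] {n : WithTop ℕ∞} {X : E × Q → E} {N : Set (E × Q)} {φ : ℝ → E × Q → E}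
  {p : E × Q} {T : ℝ}

theorem eventually_forall_mem (h : IsLocalParamFlow n X N φ)
    (hp : ∀ t ∈ Icc 0 T, (φ t p, p.2) ∈ N) :
    ∀ᶠ p' in 𝓝 p, ∀ t ∈ Icc 0 T, (φ t p', p'.2) ∈ N := by
  refine isCompact_Icc.eventually_forall_of_forall_eventually
    (P := fun p' t => (φ t p', p'.2) ∈ N) fun t ht => ?_
  have hcont : Continuous fun x : (E × Q) × ℝ => (φ x.2 x.1, x.1.2) :=
    (h.contDiff.continuous.comp continuous_swap).prodMk continuous_fst.snd
  exact hcont.continuousAt.eventually (h.isOpen.mem_nhds (hp t ht))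

theorem fderiv_zero (h : IsLocalParamFlow n X N φ) (p : E × Q) :
    fderiv ℝ (φ 0) p = ContinuousLinearMap.fst ℝ E Q := by
  rw [funext h.zero]
  exact hasFDerivAt_fst.fderiv

theorem continuousOn_fderiv_field (h : IsLocalParamFlow n X N φ) (hn : n ≠ 0)
    (hp : ∀ t ∈ Icc 0 T, (φ t p, p.2) ∈ N) :
    ContinuousOn (fun t => fderiv ℝ X (φ t p, p.2)) (Icc 0 T) := by
  have hφ : Continuous fun t => (φ t p, p.2) :=
    (h.contDiff.continuous.comp (Continuous.prodMk_left p)).prodMk continuous_const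
  exact (h.contDiffOn_field.continuousOn_fderiv_of_isOpen h.isOpen
    (ENat.one_le_iff_ne_zero_withTop.2 hn)).comp hφ.continuousOn hp

theorem hasDerivAt_fderiv_comp_inl (h : IsLocalParamFlow n X N φ) {t : ℝ}
    (hp : (φ t p, p.2) ∈ N) :
    HasDerivAt (fun s => (fderiv ℝ (φ s) p).comp (.inl ℝ E Q))
      (((fderiv ℝ X (φ t p, p.2)).comp (.inl ℝ E Q)).comp
        ((fderiv ℝ (φ t) p).comp (.inl ℝ E Q))) t :=
  ((h.hasDerivAt_fderiv t p hp).clm_comp (hasDerivAt_const t _)).congr_deriv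
    (ContinuousLinearMap.ext fun _ => by simp)

theorem hasDerivAt_fderiv_apply_snd (h : IsLocalParamFlow n X N φ) {t : ℝ}
    (hp : (φ t p, p.2) ∈ N) (v : Q) :
    HasDerivAt (fun s => fderiv ℝ (φ s) p (0, v))
      ((fderiv ℝ X (φ t p, p.2)).comp (.inl ℝ E Q) (fderiv ℝ (φ t) p (0, v)) +
        fderiv ℝ X (φ t p, p.2) (0, v)) t :=
  ((h.hasDerivAt_fderiv t p hp).clm_apply (hasDerivAt_const t _)).congr_deriv
    (by simp [← map_add])

variable [FiniteDimensional ℝ E]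

theorem continuousOn_inverse_apply (h : IsLocalParamFlow n X N φ) (hn : n ≠ 0)
    (hp : ∀ t ∈ Icc 0 T, (φ t p, p.2) ∈ N) (v : Q) :
    ContinuousOn (fun t => ((fderiv ℝ (φ t) p).comp (.inl ℝ E Q)).inverse
      (fderiv ℝ X (φ t p, p.2) (0, v))) (Icc 0 T) :=
  have hX := h.continuousOn_fderiv_field hn hp
  (continuousOn_inverse_fundamentalMatrix (hX.clm_comp continuousOn_const)
    (fun t ht => (h.hasDerivAt_fderiv_comp_inl (hp t ht)).hasDerivWithinAt)
    (by ext; simp [h.fderiv_zero])).clm_apply (hX.clm_apply continuousOn_const)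

theorem fderiv_apply_snd_eq (h : IsLocalParamFlow n X N φ) (hn : n ≠ 0) (hT : 0 ≤ T)
    (hp : ∀ t ∈ Icc 0 T, (φ t p, p.2) ∈ N) (v : Q) :
    fderiv ℝ (φ T) p (0, v) = (fderiv ℝ (φ T) p).comp (.inl ℝ E Q)
      (∫ t in (0 : ℝ)..T, ((fderiv ℝ (φ t) p).comp (.inl ℝ E Q)).inverse
        (fderiv ℝ X (φ t p, p.2) (0, v))) :=
  have hX := h.continuousOn_fderiv_field hn hp
  eq_fundamentalMatrix_apply_integral hT (hX.clm_comp continuousOn_const)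
    (hX.clm_apply continuousOn_const)
    (fun t ht => (h.hasDerivAt_fderiv_comp_inl (hp t ht)).hasDerivWithinAt)
    (by ext; simp [h.fderiv_zero])
    (fun t ht => (h.hasDerivAt_fderiv_apply_snd (hp t ht) v).hasDerivWithinAt)
    (by simp [h.fderiv_zero])

end IsLocalParamFlow

section PlanarFlow

variable {F : ℝ × ℝ → ℝ × ℝ} {D : Set (ℝ × ℝ)} {u v : ℝ → ℝ × ℝ} {T : ℝ}

theorem IsSolOn.continuousOn {J : Set ℝ} (hu : IsSolOn F D J u) : ContinuousOn u J :=
  fun t ht => (hu t ht).2.continuousWithinAt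

theorem IsSolOn.mono {J J' : Set ℝ} (hu : IsSolOn F D J u) (h : J' ⊆ J) : IsSolOn F D J' u :=
  fun t ht => ⟨(hu t (h ht)).1, (hu t (h ht)).2.mono h⟩

theorem IsSolOn.eqOn (hD : IsOpen D) (hF : ContDiffOn ℝ 1 F D) (hu : IsSolOn F D (Icc 0 T) u)
    (hv : IsSolOn F D (Icc 0 T) v) (h0 : u 0 = v 0) : EqOn u v (Icc 0 T) := by
  set C := u '' Icc 0 T ∪ v '' Icc 0 T
  have hC : IsCompact C := (isCompact_Icc.image_of_continuousOn hu.continuousOn).union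
    (isCompact_Icc.image_of_continuousOn hv.continuousOn)
  have hCD : C ⊆ D := by
    rintro _ (⟨t, ht, rfl⟩ | ⟨t, ht, rfl⟩)
    exacts [(hu t ht).1, (hv t ht).1]
  obtain ⟨K, hK⟩ : ∃ K, LipschitzOnWith K F C :=
    LocallyLipschitzOn.exists_lipschitzOnWith_of_compact hC fun x hx => by
      obtain ⟨K, t, ht, h⟩ := (hF.contDiffAt (hD.mem_nhds (hCD hx))).exists_lipschitzOnWith
      exact ⟨K, t, mem_nhdsWithin_of_mem_nhds ht, h⟩
  have hderiv : ∀ w, IsSolOn F D (Icc 0 T) w → ∀ t ∈ Ico 0 T,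
      HasDerivWithinAt w (F (w t)) (Ici t) t := fun w hw t ht =>
    (hw t (Ico_subset_Icc_self ht)).2.mono_of_mem_nhdsWithin (Icc_mem_nhdsGE_of_mem ht)
  exact ODE_solution_unique_of_mem_Icc_right (v := fun _ => F) (s := fun _ => C) (fun _ _ => hK)
    hu.continuousOn (hderiv u hu)
    (fun t ht => Or.inl (mem_image_of_mem u (Ico_subset_Icc_self ht)))
    hv.continuousOn (hderiv v hv)
    (fun t ht => Or.inr (mem_image_of_mem v (Ico_subset_Icc_self ht))) h0

theorem IsSolOn.flow_eq (hD : IsOpen D) (hF : ContDiffOn ℝ 1 F D) (hT : 0 ≤ T)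
    (hu : IsSolOn F D (Icc 0 T) u) : flow F D T (u 0) = u T := by
  have hdom : InFlowDomain F D T (u 0) := ⟨u, rfl, by rwa [uIcc_of_le hT]⟩
  rw [flow, dif_pos hdom]
  exact IsSolOn.eqOn hD hF (uIcc_of_le hT ▸ hdom.choose_spec.2) hu hdom.choose_spec.1 ⟨hT, le_rfl⟩

theorem ReachesAt.returnTime_eq {x s : ℝ} (h : ReachesAt F D x s) : returnTime F D x = s := by
  obtain ⟨hs, hdom, hneg, hzero, -⟩ := h
  refine IsLeast.csInf_eq ⟨⟨hs, hdom, hzero⟩, ?_⟩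
  rintro t ⟨ht, -, htzero⟩
  exact not_lt.1 fun hts => (hneg t ⟨ht, hts⟩).ne htzero

/-- The value at time `T` of the solution of `w' = DF(Γ(t, z)) w + g(t, Γ(t, z))`, `w(0) = 0`, in
the form given by variation of constants. -/
noncomputable def flowVariation (F : ℝ × ℝ → ℝ × ℝ) (D : Set (ℝ × ℝ)) (g : ℝ → ℝ × ℝ → ℝ × ℝ)
    (T : ℝ) (z : ℝ × ℝ) : ℝ × ℝ :=
  fundamental F D T z (∫ t in (0 : ℝ)..T, (fundamental F D t z).inverse (g t (flow F D t z)))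

namespace IsLocalParamFlow

variable {X : (ℝ × ℝ) × ℝ → ℝ × ℝ} {N : Set ((ℝ × ℝ) × ℝ)} {φ : ℝ → (ℝ × ℝ) × ℝ → ℝ × ℝ}
  {n : WithTop ℕ∞} {z : ℝ × ℝ} {q : ℝ}

theorem isSolOn (h : IsLocalParamFlow n X N φ) (hN : MapsTo Prod.fst N D)
    (hz : ∀ t ∈ Icc 0 T, (φ t (z, q), q) ∈ N) :
    IsSolOn (fun w => X (w, q)) D (Icc 0 T) fun t => φ t (z, q) :=
  fun t ht => ⟨hN (hz t ht), (h.hasDerivAt t (z, q) (hz t ht)).hasDerivWithinAt⟩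

theorem flow_eq (h : IsLocalParamFlow n X N φ) (hD : IsOpen D)
    (hX : ContDiffOn ℝ 1 (fun w => X (w, q)) D) (hN : MapsTo Prod.fst N D) (hT : 0 ≤ T)
    (hz : ∀ t ∈ Icc 0 T, (φ t (z, q), q) ∈ N) :
    flow (fun w => X (w, q)) D T z = φ T (z, q) := by
  simpa only [h.zero] using (h.isSolOn hN hz).flow_eq hD hX hT

theorem fundamental_eq (h : IsLocalParamFlow n X N φ) (hn : n ≠ 0) (hD : IsOpen D)
    (hX : ContDiffOn ℝ 1 (fun w => X (w, q)) D) (hN : MapsTo Prod.fst N D) (hT : 0 ≤ T)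
    (hz : ∀ t ∈ Icc 0 T, (φ t (z, q), q) ∈ N) :
    fundamental (fun w => X (w, q)) D T z =
      (fderiv ℝ (φ T) (z, q)).comp (.inl ℝ (ℝ × ℝ) ℝ) := by
  have heq : (fun w => flow (fun w => X (w, q)) D T w) =ᶠ[𝓝 z] fun w => φ T (w, q) := by
    have hc : ContinuousAt (fun w : ℝ × ℝ => (w, q)) z := by fun_prop
    filter_upwards [hc.eventually (h.eventually_forall_mem hz)] with w hw
    exact h.flow_eq hD hX hN hT hw
  have hφ : Differentiable ℝ (φ T) :=
    (h.contDiff.comp (contDiff_const.prodMk contDiff_id)).differentiable hn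
  rw [fundamental, heq.fderiv_eq]
  exact ((hφ _).hasFDerivAt.comp z (hasFDerivAt_prodMk_left z q)).fderiv

theorem intervalIntegrable_inverse_fundamental (h : IsLocalParamFlow n X N φ) (hn : n ≠ 0)
    (hD : IsOpen D) (hX : ContDiffOn ℝ 1 (fun w => X (w, q)) D) (hN : MapsTo Prod.fst N D)
    (hT : 0 ≤ T) (hz : ∀ t ∈ Icc 0 T, (φ t (z, q), q) ∈ N) :
    IntervalIntegrable (fun t => (fundamental (fun w => X (w, q)) D t z).inverse
      (fderiv ℝ X (flow (fun w => X (w, q)) D t z, q) (0, 1))) MeasureTheory.volume 0 T := by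
  refine ContinuousOn.intervalIntegrable_of_Icc hT
    ((h.continuousOn_inverse_apply hn hz 1).congr fun t ht => ?_)
  have hzt : ∀ s ∈ Icc 0 t, (φ s (z, q), q) ∈ N := fun s hs => hz s ⟨hs.1, hs.2.trans ht.2⟩
  rw [h.fundamental_eq hn hD hX hN ht.1 hzt, h.flow_eq hD hX hN ht.1 hzt]

theorem fderiv_apply_snd_eq_flowVariation (h : IsLocalParamFlow n X N φ) (hn : n ≠ 0)
    (hD : IsOpen D) (hX : ContDiffOn ℝ 1 (fun w => X (w, q)) D) (hN : MapsTo Prod.fst N D)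
    (hT : 0 ≤ T) (hz : ∀ t ∈ Icc 0 T, (φ t (z, q), q) ∈ N) :
    fderiv ℝ (φ T) (z, q) (0, 1) =
      flowVariation (fun w => X (w, q)) D (fun _ w => fderiv ℝ X (w, q) (0, 1)) T z := by
  rw [flowVariation, h.fundamental_eq hn hD hX hN hT hz, h.fderiv_apply_snd_eq hn hT hz]
  congr 1
  refine intervalIntegral.integral_congr fun t ht => ?_
  rw [uIcc_of_le hT] at ht
  have hzt : ∀ s ∈ Icc 0 t, (φ s (z, q), q) ∈ N := fun s hs => hz s ⟨hs.1, hs.2.trans ht.2⟩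
  simp only [h.fundamental_eq hn hD hX hN ht.1 hzt, h.flow_eq hD hX hN ht.1 hzt]

end IsLocalParamFlow

end PlanarFlow

section HittingTime

variable {Q : Type*} [NormedAddCommGroup Q] [NormedSpace ℝ Q] {f : Q × ℝ → ℝ} {q₀ : Q}

theorem isInvertible_of_apply_one_ne_zero {L : ℝ →L[ℝ] ℝ} (h : L 1 ≠ 0) : L.IsInvertible :=
  ⟨ContinuousLinearEquiv.unitsEquivAut ℝ (Units.mk0 (L 1) h), by ext; simp⟩

theorem eventually_lt_of_fderiv_apply_snd_neg {t₀ : ℝ} (hf : ContDiffAt ℝ 1 f (q₀, t₀))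
    (hneg : fderiv ℝ f (q₀, t₀) (0, 1) < 0) :
    ∀ᶠ x : Q × ℝ × ℝ in 𝓝 (q₀, t₀, t₀), x.2.1 < x.2.2 → f (x.1, x.2.2) < f (x.1, x.2.1) := by
  have hstrict := (hf.hasStrictFDerivAt one_ne_zero).isLittleO.def
    (half_pos (neg_pos.2 hneg))
  have hpair : ContinuousAt (fun x : Q × ℝ × ℝ => ((x.1, x.2.2), (x.1, x.2.1))) (q₀, t₀, t₀) := by
    fun_prop
  filter_upwards [hpair.eventually hstrict] with x hx hlt
  have hsub : ((x.1, x.2.2) : Q × ℝ) - (x.1, x.2.1) = (x.2.2 - x.2.1) • (0, 1) := by simp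
  have hpos := sub_pos.2 hlt
  have hnorm : ‖((0 : Q), (1 : ℝ))‖ = 1 := by simp [Prod.norm_def]
  rw [hsub, map_smul, norm_smul, hnorm, Real.norm_of_nonneg hpos.le] at hx
  have := (abs_le.1 hx).2
  simp only [smul_eq_mul] at this
  nlinarith

theorem eventually_neg_of_gt_of_fderiv_neg {T : Q → ℝ} (hf : ContDiffAt ℝ 1 f (q₀, T q₀))
    (hT : ContinuousAt T q₀) (hzero : ∀ᶠ q in 𝓝 q₀, f (q, T q) = 0)
    (hneg : fderiv ℝ f (q₀, T q₀) (0, 1) < 0) :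
    ∀ᶠ p in 𝓝 (q₀, T q₀), T p.1 < p.2 → f p < 0 := by
  have hpair : ContinuousAt (fun p : Q × ℝ => (p.1, T p.1, p.2)) (q₀, T q₀) :=
    continuousAt_fst.prodMk ((hT.comp continuousAt_fst).prodMk continuousAt_snd)
  filter_upwards [hpair.eventually (eventually_lt_of_fderiv_apply_snd_neg hf hneg),
    continuousAt_fst.eventually hzero] with p hp hp0 hlt using (hp hlt).trans_eq hp0

theorem eventually_neg_of_lt_of_fderiv_pos {T : Q → ℝ} (hf : ContDiffAt ℝ 1 f (q₀, T q₀))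
    (hT : ContinuousAt T q₀) (hzero : ∀ᶠ q in 𝓝 q₀, f (q, T q) = 0)
    (hpos : 0 < fderiv ℝ f (q₀, T q₀) (0, 1)) :
    ∀ᶠ p in 𝓝 (q₀, T q₀), p.2 < T p.1 → f p < 0 := by
  have hpair : ContinuousAt (fun p : Q × ℝ => (p.1, p.2, T p.1)) (q₀, T q₀) :=
    continuousAt_fst.prodMk (continuousAt_snd.prodMk (hT.comp continuousAt_fst))
  have hlt := eventually_lt_of_fderiv_apply_snd_neg hf.neg
    (by simpa [fderiv_fun_neg] using hpos)
  filter_upwards [hpair.eventually hlt, continuousAt_fst.eventually hzero] with p hp hp0 hpT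
  have := hp hpT
  simp only [hp0] at this
  linarith

theorem eventually_forall_Ioo_neg {T : Q → ℝ} (hf : ContDiff ℝ 1 f) (hT : ContinuousAt T q₀)
    (hzero : ∀ q, f (q, 0) = 0) (hTzero : ∀ᶠ q in 𝓝 q₀, f (q, T q) = 0)
    (hneg : ∀ t ∈ Ioo 0 (T q₀), f (q₀, t) < 0) (h0 : fderiv ℝ f (q₀, 0) (0, 1) < 0)
    (h1 : 0 < fderiv ℝ f (q₀, T q₀) (0, 1)) :
    ∀ᶠ q in 𝓝 q₀, ∀ t ∈ Ioo 0 (T q), f (q, t) < 0 := by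
  have hTfst : ∀ τ, ContinuousAt (fun p : Q × ℝ => T p.1) (q₀, τ) := fun τ =>
    hT.comp continuousAt_fst
  have hlocal : ∀ᶠ q in 𝓝 q₀, ∀ t ∈ Icc 0 (T q₀ + 1), 0 < t → t < T q → f (q, t) < 0 := by
    refine isCompact_Icc.eventually_forall_of_forall_eventually
      (P := fun q t => 0 < t → t < T q → f (q, t) < 0) fun τ hτ => ?_
    rcases hτ.1.eq_or_lt with rfl | hτ0
    · filter_upwards [eventually_neg_of_gt_of_fderiv_neg (T := 0) hf.contDiffAt continuousAt_const
        (Eventually.of_forall hzero) h0] with p hp hpos _ using hp hpos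
    rcases lt_trichotomy τ (T q₀) with hτT | rfl | hτT
    · filter_upwards [hf.continuous.continuousAt.eventually_lt continuousAt_const
        (hneg τ ⟨hτ0, hτT⟩)] with p hp _ _ using hp
    · filter_upwards [eventually_neg_of_lt_of_fderiv_pos hf.contDiffAt hT hTzero h1]
        with p hp _ hpT using hp hpT
    · filter_upwards [(hTfst τ).eventually_lt continuousAt_snd hτT] with p hp _ hpT
      exact absurd hpT hp.not_gt
  filter_upwards [hlocal, hT.eventually (gt_mem_nhds (lt_add_one (T q₀)))] with q hq hTq t ht
  exact hq t ⟨ht.1.le, (ht.2.trans hTq).le⟩ ht.1 ht.2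

theorem exists_hittingTime [CompleteSpace Q] {n : WithTop ℕ∞} (hn : n ≠ 0) (hf : ContDiff ℝ n f)
    (hzero : ∀ q, f (q, 0) = 0) {s : ℝ} (hs : 0 < s) (hneg : ∀ t ∈ Ioo 0 s, f (q₀, t) < 0)
    (hsz : f (q₀, s) = 0) (h0 : fderiv ℝ f (q₀, 0) (0, 1) < 0)
    (h1 : 0 < fderiv ℝ f (q₀, s) (0, 1)) :
    ∃ T : Q → ℝ, ContDiffAt ℝ n T q₀ ∧ T q₀ = s ∧
      ∀ᶠ q in 𝓝 q₀, 0 < T q ∧ f (q, T q) = 0 ∧ ∀ t ∈ Ioo 0 (T q), f (q, t) < 0 := by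
  have hfs : ContDiffAt ℝ n f (q₀, s) := hf.contDiffAt
  have hinv : (fderiv ℝ f (q₀, s) ∘L .inr ℝ Q ℝ).IsInvertible :=
    isInvertible_of_apply_one_ne_zero (by simpa using h1.ne')
  set T := hfs.implicitFunction hn hinv
  have hTs : T q₀ = s := hfs.implicitFunction_apply_self hn hinv
  have hTsmooth : ContDiffAt ℝ n T q₀ := hfs.contDiffAt_implicitFunction hn hinv
  have hTzero : ∀ᶠ q in 𝓝 q₀, f (q, T q) = 0 := by
    simpa only [hsz] using hfs.eventually_apply_implicitFunction hn hinv
  have hTneg : ∀ᶠ q in 𝓝 q₀, ∀ t ∈ Ioo 0 (T q), f (q, t) < 0 :=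
    eventually_forall_Ioo_neg (hf.of_le (ENat.one_le_iff_ne_zero_withTop.2 hn))
      hTsmooth.continuousAt hzero hTzero (hTs ▸ hneg) h0 (hTs ▸ h1)
  refine ⟨T, hTsmooth, hTs, ?_⟩
  filter_upwards [hTsmooth.continuousAt.eventually (lt_mem_nhds (hTs ▸ hs)), hTzero, hTneg]
    with q hq1 hq2 hq3 using ⟨hq1, hq2, hq3⟩

end HittingTime

section HalfOrbit

theorem nonpos_of_isMaxOn_Icc_left {g : ℝ → ℝ} {c a b : ℝ} (hab : a < b)
    (hg : HasDerivWithinAt g c (Icc a b) a) (hmax : IsMaxOn g (Icc a b) a) : c ≤ 0 := by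
  have hcone : b - a ∈ posTangentConeAt (Icc a b) a :=
    sub_mem_posTangentConeAt_of_segment_subset (segment_eq_Icc hab.le).subset
  have h := hmax.localize.hasFDerivWithinAt_nonpos hg.hasFDerivWithinAt hcone
  simp only [ContinuousLinearMap.toSpanSingleton_apply, smul_eq_mul] at h
  exact nonpos_of_mul_nonpos_right h (sub_pos.2 hab)

theorem nonneg_of_isMaxOn_Icc_right {g : ℝ → ℝ} {c a b : ℝ} (hab : a < b)
    (hg : HasDerivWithinAt g c (Icc a b) b) (hmax : IsMaxOn g (Icc a b) b) : 0 ≤ c := by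
  have hcone : a - b ∈ posTangentConeAt (Icc a b) b :=
    sub_mem_posTangentConeAt_of_segment_subset (segment_symm ℝ a b ▸ segment_eq_Icc hab.le).subset
  have h := hmax.localize.hasFDerivWithinAt_nonpos hg.hasFDerivWithinAt hcone
  simp only [ContinuousLinearMap.toSpanSingleton_apply, smul_eq_mul] at h
  exact nonneg_of_mul_nonpos_right h (sub_neg.2 hab)

/-- `u` solves `z' = X(z)` on `[0, T]`, leaves the switching line transversely at `(x, 0)`, runs
through `y < 0`, and comes back to the switching line transversely at `(P, 0)` at time `T`. -/
structure IsHalfOrbit (X : ℝ × ℝ → ℝ × ℝ) (D : Set (ℝ × ℝ)) (x T P : ℝ) (u : ℝ → ℝ × ℝ) :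
    Prop where
  pos : 0 < T
  start : u 0 = (x, 0)
  finish : u T = (P, 0)
  isSolOn : IsSolOn X D (Icc 0 T) u
  neg : ∀ t ∈ Ioo 0 T, (u t).2 < 0
  snd_start_neg : (X (x, 0)).2 < 0
  snd_finish_pos : 0 < (X (P, 0)).2

variable {F : ℝ × ℝ → ℝ × ℝ} {D : Set (ℝ × ℝ)} {u : ℝ → ℝ × ℝ} {x s P : ℝ}

namespace IsHalfOrbit

theorem snd_nonpos (h : IsHalfOrbit F D x s P u) : ∀ t ∈ Icc 0 s, (u t).2 ≤ 0 := by
  rintro t ⟨ht0, hts⟩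
  rcases ht0.eq_or_lt with rfl | ht0
  · simp [h.start]
  rcases hts.eq_or_lt with rfl | hts
  · simp [h.finish]
  exact (h.neg t ⟨ht0, hts⟩).le

theorem flow_eq (hD : IsOpen D) (hF : ContDiffOn ℝ 1 F D) (h : IsHalfOrbit F D x s P u) {t : ℝ}
    (ht : t ∈ Icc 0 s) : flow F D t (x, 0) = u t := by
  rw [← h.start]
  exact (h.isSolOn.mono (Icc_subset_Icc_right ht.2)).flow_eq hD hF ht.1

theorem reachesAt (hD : IsOpen D) (hF : ContDiffOn ℝ 1 F D) (h : IsHalfOrbit F D x s P u) :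
    ReachesAt F D x s := by
  have hend : flow F D s (x, 0) = (P, 0) :=
    (h.flow_eq hD hF ⟨h.pos.le, le_rfl⟩).trans h.finish
  refine ⟨h.pos, ⟨u, h.start, by simpa only [uIcc_of_le h.pos.le] using h.isSolOn⟩,
    fun t ht => ?_, by rw [hend], by rw [hend]; exact h.snd_finish_pos.ne'⟩
  rw [h.flow_eq hD hF (Ioo_subset_Icc_self ht)]
  exact h.neg t ht

end IsHalfOrbit

theorem ReachesAt.exists_isHalfOrbit (hD : IsOpen D) (hF : ContDiffOn ℝ 1 F D)
    (h : ReachesAt F D x s) (hne : (F (x, 0)).2 ≠ 0) : ∃ P u, IsHalfOrbit F D x s P u := by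
  obtain ⟨hs, ⟨u, hu0, hu⟩, hneg, hzero, hne'⟩ := h
  rw [uIcc_of_le hs.le] at hu
  have hflow : ∀ t ∈ Icc 0 s, flow F D t (x, 0) = u t := fun t ht =>
    hu0 ▸ (hu.mono (Icc_subset_Icc_right ht.2)).flow_eq hD hF ht.1
  have h0 : (0 : ℝ) ∈ Icc 0 s := ⟨le_rfl, hs.le⟩
  have h1 : s ∈ Icc 0 s := ⟨hs.le, le_rfl⟩
  rw [hflow s h1] at hzero hne'
  have husnd : ∀ t ∈ Icc 0 s, (u t).2 ≤ 0 := fun t ht => by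
    rcases ht.1.eq_or_lt with rfl | ht0
    · simp [hu0]
    rcases ht.2.eq_or_lt with rfl | hts
    · exact hzero.le
    exact (hflow t ht ▸ hneg t ⟨ht0, hts⟩).le
  have hderiv : ∀ t ∈ Icc 0 s, HasDerivWithinAt (fun r => (u r).2) (F (u t)).2 (Icc 0 s) t :=
    fun t ht => (hu t ht).2.snd
  refine ⟨(u s).1, u, hs, hu0, Prod.ext rfl hzero, hu,
    fun t ht => hflow t (Ioo_subset_Icc_self ht) ▸ hneg t ht, ?_, ?_⟩
  · refine lt_of_le_of_ne (hu0 ▸ nonpos_of_isMaxOn_Icc_left hs (hderiv 0 h0) fun t ht => ?_) hne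
    simpa [hu0] using husnd t ht
  · rw [show ((u s).1, (0 : ℝ)) = u s from Prod.ext rfl hzero.symm]
    refine lt_of_le_of_ne (nonneg_of_isMaxOn_Icc_right hs (hderiv s h1) fun t ht => ?_) hne'.symm
    simpa [hzero] using husnd t ht

end HalfOrbit

section HalfReturn

theorem hasDerivAt_prodMk_right {E Q : Type*} [NormedAddCommGroup E]
    [NormedSpace ℝ E] [NormedAddCommGroup Q] [NormedSpace ℝ Q] {f : Q × ℝ → E} {q : Q} {t : ℝ}
    (hf : DifferentiableAt ℝ f (q, t)) :
    HasDerivAt (fun s => f (q, s)) (fderiv ℝ f (q, t) (0, 1)) t :=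
  hf.hasFDerivAt.comp_hasDerivAt t ((hasDerivAt_const t q).prodMk (hasDerivAt_id t))

namespace IsLocalParamFlow

section Normed

variable {E Q : Type*} [NormedAddCommGroup E] [NormedSpace ℝ E] [NormedAddCommGroup Q]
  [NormedSpace ℝ Q] {n : WithTop ℕ∞} {X : E × Q → E} {N : Set (E × Q)} {φ : ℝ → E × Q → E}

theorem eventually_forall_mem_of_tendsto (h : IsLocalParamFlow n X N φ) {A : Type*}
    {l : Filter A} {τ : A → ℝ} {π : A → E × Q} {T : ℝ} {p : E × Q} (hT : 0 ≤ T)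
    (hτ : Tendsto τ l (𝓝 T)) (hπ : Tendsto π l (𝓝 p)) (hp : ∀ t ∈ Icc 0 T, (φ t p, p.2) ∈ N) :
    ∀ᶠ a in l, ∀ t ∈ Icc 0 (τ a), (φ t (π a), (π a).2) ∈ N := by
  have hcont : Continuous fun t => (φ t p, p.2) :=
    (h.contDiff.continuous.comp (Continuous.prodMk_left p)).prodMk continuous_const
  obtain ⟨δ, hδ, hball⟩ := Metric.eventually_nhds_iff.1
    (hcont.continuousAt.eventually (h.isOpen.mem_nhds (hp T ⟨hT, le_rfl⟩)))
  have hp' : ∀ t ∈ Icc 0 (T + δ / 2), (φ t p, p.2) ∈ N := fun t ht => by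
    rcases le_total t T with htT | htT
    · exact hp t ⟨ht.1, htT⟩
    · exact hball (by rw [Real.dist_eq, abs_of_nonneg (sub_nonneg.2 htT)]; linarith [ht.2])
  filter_upwards [hπ.eventually (h.eventually_forall_mem hp'),
    hτ.eventually (gt_mem_nhds (lt_add_of_pos_right T (half_pos hδ)))] with a ha hτa t ht
  exact ha t ⟨ht.1, ht.2.trans hτa.le⟩

theorem hasDerivAt_comp (h : IsLocalParamFlow n X N φ) (hn : n ≠ 0) {τ : ℝ → ℝ} {π : ℝ → E × Q}
    {τ' a : ℝ} {π' : E × Q} (hτ : HasDerivAt τ τ' a) (hπ : HasDerivAt π π' a)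
    (hN : (φ (τ a) (π a), (π a).2) ∈ N) :
    HasDerivAt (fun r => φ (τ r) (π r))
      (τ' • X (φ (τ a) (π a), (π a).2) + fderiv ℝ (φ (τ a)) (π a) π') a := by
  have hU := ((h.contDiff.differentiable hn) (τ a, π a)).hasFDerivAt
  have htime : fderiv ℝ (fun x : ℝ × E × Q => φ x.1 x.2) (τ a, π a) (1, 0) =
      X (φ (τ a) (π a), (π a).2) :=
    (hU.comp_hasDerivAt (f := fun t => (t, π a)) (τ a)
      ((hasDerivAt_id (τ a)).prodMk (hasDerivAt_const (τ a) (π a)))).unique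
      (h.hasDerivAt (τ a) (π a) hN)
  have hspace : fderiv ℝ (φ (τ a)) (π a) = _ :=
    (hU.comp (π a) (hasFDerivAt_prodMk_right (τ a) (π a))).fderiv
  refine (hU.comp_hasDerivAt a (hτ.prodMk hπ)).congr_deriv ?_
  rw [← htime, hspace]
  simp [← map_smul, ← map_add]

end Normed

variable {n : WithTop ℕ∞} {X : (ℝ × ℝ) × ℝ → ℝ × ℝ} {N : Set ((ℝ × ℝ) × ℝ)}
  {φ : ℝ → (ℝ × ℝ) × ℝ → ℝ × ℝ}

-- Differentiating `(φ (τ ε) (z, ε)).2 = 0` determines `τ'`, which is then eliminated.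
theorem deriv_fst_mul_snd_eq_neg_wedge (h : IsLocalParamFlow n X N φ) (hn : n ≠ 0) {τ : ℝ → ℝ}
    {z : ℝ × ℝ} {a : ℝ} (hτ : DifferentiableAt ℝ τ a) (hN : (φ (τ a) (z, a), a) ∈ N)
    (hzero : ∀ᶠ ε in 𝓝 a, (φ (τ ε) (z, ε)).2 = 0) :
    deriv (fun ε => (φ (τ ε) (z, ε)).1) a * (X (φ (τ a) (z, a), a)).2 =
      -wedge (X (φ (τ a) (z, a), a)) (fderiv ℝ (φ (τ a)) (z, a) (0, 1)) := by
  have hcurve := h.hasDerivAt_comp hn hτ.hasDerivAt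
    ((hasDerivAt_const a z).prodMk (hasDerivAt_id a)) hN
  have hfst := hasFDerivAt_fst.comp_hasDerivAt (f := fun ε => φ (τ ε) (z, ε)) a hcurve
  have hsnd := (hasFDerivAt_snd.comp_hasDerivAt (f := fun ε => φ (τ ε) (z, ε)) a hcurve).unique
    ((hasDerivAt_const a (0 : ℝ)).congr_of_eventuallyEq hzero)
  rw [show deriv (fun ε => (φ (τ ε) (z, ε)).1) a = _ from hfst.deriv]
  simp only [ContinuousLinearMap.coe_fst', ContinuousLinearMap.coe_snd', Prod.fst_add,
    Prod.smul_fst, Prod.snd_add, Prod.smul_snd, smul_eq_mul, wedge, id] at hsnd ⊢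
  linear_combination (X (φ (τ a) (z, a), a)).1 * hsnd

end IsLocalParamFlow

/-- `T` and `P` are the return time and the half-return map to the switching line of the fields
`X(·, ε)`, near the transversal half-orbit of `X(·, 0)` from `(x₀, 0)`: both take the pair
`(x, ε)` as argument. -/
structure IsHalfReturn (n : WithTop ℕ∞) (X : (ℝ × ℝ) × ℝ → ℝ × ℝ) (D : Set (ℝ × ℝ)) (x₀ : ℝ)
    (T P : ℝ × ℝ → ℝ) : Prop where
  contDiffAt : ContDiffAt ℝ n P (x₀, 0)
  eventually_isHalfOrbit : ∀ᶠ q in 𝓝 (x₀, (0 : ℝ)),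
    ∃ u, IsHalfOrbit (fun z => X (z, q.2)) D q.1 (T q) (P q) u
  eventually_intervalIntegrable : ∀ᶠ x in 𝓝 x₀,
    IntervalIntegrable (fun t => (fundamental (fun z => X (z, 0)) D t (x, 0)).inverse
      (fderiv ℝ X (flow (fun z => X (z, 0)) D t (x, 0), 0) (0, 1))) MeasureTheory.volume 0
        (T (x, 0))
  eventually_deriv_mul_eq : ∀ᶠ x in 𝓝 x₀,
    deriv (fun ε => P (x, ε)) 0 * (X ((P (x, 0), 0), 0)).2 =
      -wedge (X ((P (x, 0), 0), 0)) (flowVariation (fun z => X (z, 0)) D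
        (fun _ z => fderiv ℝ X (z, 0) (0, 1)) (T (x, 0)) (x, 0))

namespace IsLocalParamFlow

variable {n : WithTop ℕ∞} {X : (ℝ × ℝ) × ℝ → ℝ × ℝ} {N : Set ((ℝ × ℝ) × ℝ)}
  {φ : ℝ → (ℝ × ℝ) × ℝ → ℝ × ℝ} {D : Set (ℝ × ℝ)} {x₀ : ℝ} {T : ℝ × ℝ → ℝ}

theorem tendsto_snd_field_comp (h : IsLocalParamFlow n X N φ) {A : Type*} {l : Filter A}
    {τ : A → ℝ} {π : A → (ℝ × ℝ) × ℝ} {t : ℝ} {p : (ℝ × ℝ) × ℝ} (hτ : Tendsto τ l (𝓝 t))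
    (hπ : Tendsto π l (𝓝 p)) (hp : (φ t p, p.2) ∈ N) :
    Tendsto (fun a => (X (φ (τ a) (π a), (π a).2)).2) l (𝓝 (X (φ t p, p.2)).2) := by
  have hφ : Tendsto (fun a => φ (τ a) (π a)) l (𝓝 (φ t p)) :=
    (h.contDiff.continuous.tendsto (t, p)).comp (hτ.prodMk_nhds hπ)
  exact (((h.contDiffOn_field.continuousOn.continuousAt (h.isOpen.mem_nhds hp)).tendsto).comp
    (hφ.prodMk_nhds hπ.snd_nhds)).snd_nhds

theorem eventually_isHalfOrbit (h : IsLocalParamFlow n X N φ) (hN : MapsTo Prod.fst N D)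
    (hTc : ContinuousAt T (x₀, 0))
    (hmem : ∀ t ∈ Icc 0 (T (x₀, 0)), (φ t ((x₀, 0), 0), 0) ∈ N)
    (hT : ∀ᶠ q in 𝓝 (x₀, (0 : ℝ)), 0 < T q ∧ (φ (T q) ((q.1, 0), q.2)).2 = 0 ∧
      ∀ t ∈ Ioo 0 (T q), (φ t ((q.1, 0), q.2)).2 < 0)
    (h0 : (X ((x₀, 0), 0)).2 < 0) (h1 : 0 < (X (φ (T (x₀, 0)) ((x₀, 0), 0), 0)).2) :
    ∀ᶠ q in 𝓝 (x₀, (0 : ℝ)), IsHalfOrbit (fun z => X (z, q.2)) D q.1 (T q)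
      (φ (T q) ((q.1, 0), q.2)).1 fun t => φ t ((q.1, 0), q.2) := by
  have hT0 : 0 ≤ T (x₀, 0) := hT.self_of_nhds.1.le
  have hι : Tendsto (fun q : ℝ × ℝ => ((q.1, (0 : ℝ)), q.2)) (𝓝 (x₀, 0)) (𝓝 ((x₀, 0), 0)) :=
    Continuous.tendsto' (by fun_prop) _ _ rfl
  have hstart := h.tendsto_snd_field_comp (tendsto_const_nhds (x := (0 : ℝ))) hι
    (hmem 0 ⟨le_rfl, hT0⟩)
  have hfinish := h.tendsto_snd_field_comp hTc hι (hmem _ ⟨hT0, le_rfl⟩)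
  simp only [h.zero] at hstart
  filter_upwards [h.eventually_forall_mem_of_tendsto hT0 hTc hι hmem, hT,
    hstart.eventually_lt_const h0, hfinish.eventually_const_lt h1]
    with q hqmem ⟨hqpos, hqzero, hqneg⟩ hq0 hq1
  have hend : φ (T q) ((q.1, 0), q.2) = ((φ (T q) ((q.1, 0), q.2)).1, 0) := Prod.ext rfl hqzero
  exact ⟨hqpos, h.zero _, hend, h.isSolOn hN hqmem, hqneg, hq0, hend ▸ hq1⟩

theorem isHalfReturn (h : IsLocalParamFlow n X N φ) (hn : n ≠ 0) (hD : IsOpen D)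
    (hX : ContDiffOn ℝ 1 (fun z => X (z, 0)) D) (hN : MapsTo Prod.fst N D)
    (hTs : ContDiffAt ℝ n T (x₀, 0))
    (hmem : ∀ t ∈ Icc 0 (T (x₀, 0)), (φ t ((x₀, 0), 0), 0) ∈ N)
    (hT : ∀ᶠ q in 𝓝 (x₀, (0 : ℝ)), 0 < T q ∧ (φ (T q) ((q.1, 0), q.2)).2 = 0 ∧
      ∀ t ∈ Ioo 0 (T q), (φ t ((q.1, 0), q.2)).2 < 0)
    (h0 : (X ((x₀, 0), 0)).2 < 0) (h1 : 0 < (X (φ (T (x₀, 0)) ((x₀, 0), 0), 0)).2) :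
    IsHalfReturn n X D x₀ T fun q => (φ (T q) ((q.1, 0), q.2)).1 := by
  have hx : Tendsto (fun x : ℝ => (x, (0 : ℝ))) (𝓝 x₀) (𝓝 (x₀, 0)) :=
    Continuous.tendsto' (by fun_prop) _ _ rfl
  have hι : Tendsto (fun x : ℝ => ((x, (0 : ℝ)), (0 : ℝ))) (𝓝 x₀) (𝓝 ((x₀, 0), 0)) :=
    Continuous.tendsto' (by fun_prop) _ _ rfl
  have hmem' : ∀ᶠ x in 𝓝 x₀, ∀ t ∈ Icc 0 (T (x, 0)), (φ t ((x, 0), 0), 0) ∈ N :=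
    h.eventually_forall_mem_of_tendsto hT.self_of_nhds.1.le
      (hTs.continuousAt.tendsto.comp hx) hι hmem
  have hTx := hx.eventually hT.eventually_nhds
  have hTd : ∀ᶠ q in 𝓝 (x₀, (0 : ℝ)), ContDiffAt ℝ 1 T q :=
    (hTs.of_le (ENat.one_le_iff_ne_zero_withTop.2 hn)).eventually (by simp)
  refine ⟨?_, ?_, ?_, ?_⟩
  · have hpair : ContDiffAt ℝ n (fun q : ℝ × ℝ => (T q, ((q.1, (0 : ℝ)), q.2))) (x₀, 0) := by
      fun_prop
    exact contDiff_fst.contDiffAt.comp (x₀, (0 : ℝ)) (h.contDiff.contDiffAt.comp _ hpair)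
  · exact (h.eventually_isHalfOrbit hN hTs.continuousAt hmem hT h0 h1).mono fun q hq => ⟨_, hq⟩
  · filter_upwards [hTx, hmem'] with x hx hxmem
    exact h.intervalIntegrable_inverse_fundamental hn hD hX hN hx.self_of_nhds.1.le hxmem
  · filter_upwards [hTx, hmem', hx.eventually hTd] with x hx hxmem hxd
    obtain ⟨hpos, hzero, -⟩ := hx.self_of_nhds
    have hend : φ (T (x, 0)) ((x, 0), 0) = ((φ (T (x, 0)) ((x, 0), 0)).1, 0) :=
      Prod.ext rfl hzero
    simp only [← hend]
    rw [← h.fderiv_apply_snd_eq_flowVariation hn hD hX hN hpos.le hxmem]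
    have hε : Tendsto (fun ε : ℝ => (x, ε)) (𝓝 0) (𝓝 (x, 0)) :=
      Continuous.tendsto' (by fun_prop) _ _ rfl
    exact h.deriv_fst_mul_snd_eq_neg_wedge hn
      (hasDerivAt_prodMk_right (hxd.differentiableAt one_ne_zero)).differentiableAt
      (hxmem _ ⟨hpos.le, le_rfl⟩) (hε.eventually (hx.mono fun q hq => hq.2.1))

end IsLocalParamFlow

theorem exists_isHalfReturn {n : ℕ} (hn : n ≠ 0) {D : Set (ℝ × ℝ)} (hD : IsOpen D) {I : Set ℝ}
    (hI : I ∈ 𝓝 0) {X : (ℝ × ℝ) × ℝ → ℝ × ℝ} (hX : ContDiffOn ℝ n X (D ×ˢ I)) {x₀ s P₀ : ℝ}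
    {u : ℝ → ℝ × ℝ} (hu : IsHalfOrbit (fun z => X (z, 0)) D x₀ s P₀ u) :
    ∃ T P : ℝ × ℝ → ℝ, IsHalfReturn n X D x₀ T P := by
  have hn' : (n : WithTop ℕ∞) ≠ 0 := by exact_mod_cast hn
  have hI0 : (0 : ℝ) ∈ interior I := mem_interior_iff_mem_nhds.2 hI
  obtain ⟨N, φ, h, hND, hφ⟩ := exists_isLocalParamFlow (q := (0 : ℝ)) hn
    (hD.prod isOpen_interior) (hX.mono (prod_mono_right interior_subset))
    (fun t ht => ⟨(hu.isSolOn t ht).1, hI0⟩) fun t ht => (hu.isSolOn t ht).2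
  simp only [hu.start] at hφ
  have hX0 : ContDiffOn ℝ 1 (fun z => X (z, 0)) D :=
    (hX.of_le (ENat.one_le_iff_ne_zero_withTop.2 hn')).comp
      (contDiff_prodMk_left 0).contDiffOn fun z hz => ⟨hz, mem_of_mem_nhds hI⟩
  set f : (ℝ × ℝ) × ℝ → ℝ := fun a => (φ a.2 ((a.1.1, 0), a.1.2)).2
  have hf : ContDiff ℝ n f := (h.contDiff.comp
    (g := fun x : ℝ × (ℝ × ℝ) × ℝ => φ x.1 x.2)
    (f := fun a : (ℝ × ℝ) × ℝ => (a.2, ((a.1.1, (0 : ℝ)), a.1.2))) (by fun_prop)).snd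
  have hfderiv : ∀ t ∈ Icc 0 s, fderiv ℝ f ((x₀, 0), t) (0, 1) = (X (u t, 0)).2 := fun t ht =>
    (hasDerivAt_prodMk_right (hf.differentiable hn' _)).unique <| (hφ t ht).2 ▸
      hasFDerivAt_snd.comp_hasDerivAt t (h.hasDerivAt t ((x₀, 0), 0) ((hφ t ht).2 ▸ (hφ t ht).1))
  obtain ⟨T, hTs, rfl, hT⟩ := exists_hittingTime (q₀ := (x₀, (0 : ℝ))) hn' hf
    (fun q => by simp [f, h.zero]) hu.pos
    (fun t ht => by simpa [f, (hφ t (Ioo_subset_Icc_self ht)).2] using hu.neg t ht)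
    (by simp [f, (hφ s ⟨hu.pos.le, le_rfl⟩).2, hu.finish])
    (by simpa [hfderiv 0 ⟨le_rfl, hu.pos.le⟩, hu.start] using hu.snd_start_neg)
    (by simpa [hfderiv s ⟨hu.pos.le, le_rfl⟩, hu.finish] using hu.snd_finish_pos)
  exact ⟨T, _, h.isHalfReturn hn' hD hX0 (fun p hp => (hND hp).1) hTs
    (fun t ht => (hφ t ht).2 ▸ (hφ t ht).1) hT hu.snd_start_neg
    (by simpa [(hφ _ ⟨hu.pos.le, le_rfl⟩).2, hu.finish] using hu.snd_finish_pos)⟩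

end HalfReturn

section Gluing

variable {A B : ℝ × ℝ → ℝ × ℝ} {D : Set (ℝ × ℝ)} {u : ℝ → ℝ × ℝ} {T : ℝ}

/-- The involution `R` as a continuous linear map. -/
def reflection : ℝ × ℝ →L[ℝ] ℝ × ℝ :=
  (ContinuousLinearMap.fst ℝ ℝ ℝ).prod (-ContinuousLinearMap.snd ℝ ℝ ℝ)

theorem reversed_snd_of_snd_eq_zero (B : ℝ × ℝ → ℝ × ℝ) (x : ℝ) :
    (reversed B (x, 0)).2 = (B (x, 0)).2 := by
  simp [reversed, R]

theorem IsSolOn.congr {J : Set ℝ} {v : ℝ → ℝ × ℝ} (hu : IsSolOn A D J u) (hvu : EqOn v u J) :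
    IsSolOn A D J v := fun t ht => by
  rw [hvu ht]
  exact ⟨(hu t ht).1, (hu t ht).2.congr hvu (hvu ht)⟩

theorem IsSolOn.of_reversed {J J' : Set ℝ} {c : ℝ} (hRD : MapsTo R D D)
    (hu : IsSolOn (reversed B) D J u) (hJ : MapsTo (fun t => c - t) J' J) :
    IsSolOn B D J' fun t => R (u (c - t)) := fun t ht => by
  obtain ⟨hmem, hderiv⟩ := hu (c - t) (hJ ht)
  have h := hderiv.scomp t ((hasDerivWithinAt_id t J').const_sub c) hJ
  refine ⟨hRD hmem, (reflection.hasFDerivAt.comp_hasDerivWithinAt t h).congr_deriv ?_⟩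
  simp [reversed, R, reflection]

/-- At time `t` the curve `u` is either off the switching line and follows `A` in `y < 0` or `B`
in `y > 0`, or it crosses the switching line downwards or upwards. -/
inductive FollowsAt (A B : ℝ × ℝ → ℝ × ℝ) (u : ℝ → ℝ × ℝ) (t : ℝ) : Prop
  | lower (hneg : (u t).2 < 0) (h : HasDerivAt u (A (u t)) t)
  | upper (hpos : 0 < (u t).2) (h : HasDerivAt u (B (u t)) t)
  | down (hzero : (u t).2 = 0) (hA : (A (u t)).2 < 0) (hB : (B (u t)).2 < 0)
      (hl : HasDerivWithinAt u (B (u t)) (Iic t) t) (hr : HasDerivWithinAt u (A (u t)) (Ici t) t)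
  | up (hzero : (u t).2 = 0) (hA : 0 < (A (u t)).2) (hB : 0 < (B (u t)).2)
      (hl : HasDerivWithinAt u (A (u t)) (Iic t) t) (hr : HasDerivWithinAt u (B (u t)) (Ici t) t)

theorem hasDerivWithinAt_of_periodic (hu : Function.Periodic u T) {J J' : Set ℝ} {t : ℝ}
    {c : ℝ × ℝ} (hJ : MapsTo (fun r => r - T) J J') (h : HasDerivWithinAt u c J' (t - T)) :
    HasDerivWithinAt u c J t := by
  have h' := h.scomp t ((hasDerivWithinAt_id t J).sub_const T) hJ
  rw [one_smul] at h'
  exact h'.congr (fun r _ => (hu.sub_eq r).symm) (hu.sub_eq t).symm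

theorem FollowsAt.add_period (hu : Function.Periodic u T) {t : ℝ} (h : FollowsAt A B u t) :
    FollowsAt A B u (t + T) := by
  have hshift : ∀ {J J' : Set ℝ} {c : ℝ × ℝ}, MapsTo (fun r => r - T) J J' →
      HasDerivWithinAt u c J' t → HasDerivWithinAt u c J (t + T) := fun hJ h =>
    hasDerivWithinAt_of_periodic hu hJ (by rwa [add_sub_cancel_right])
  have hIic : MapsTo (fun r => r - T) (Iic (t + T)) (Iic t) := fun r hr => by
    simpa using hr
  have hIci : MapsTo (fun r => r - T) (Ici (t + T)) (Ici t) := fun r hr => by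
    simpa [le_sub_iff_add_le] using hr
  have huniv : ∀ {c : ℝ × ℝ}, HasDerivAt u c t → HasDerivAt u c (t + T) := fun h =>
    hasDerivWithinAt_univ.1 (hshift (mapsTo_univ _ _) h.hasDerivWithinAt)
  cases h <;> [apply lower; apply upper; apply down; apply up] <;> rw [hu t] <;>
    solve_by_elim

theorem FollowsAt.periodic (hu : Function.Periodic u T) :
    Function.Periodic (FollowsAt A B u) T := fun t => by
  refine propext ⟨fun h => ?_, fun h => h.add_period hu⟩
  simpa using h.add_period hu.neg

theorem isCrossingSolution_of_followsAt {Xp Xm : ℝ → ℝ × ℝ → ℝ × ℝ}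
    (hA : ∀ t, EqOn (Xm t) A (D ∩ Prod.snd ⁻¹' Iic 0))
    (hB : ∀ t, EqOn (Xp t) B (D ∩ Prod.snd ⁻¹' Ici 0))
    (hmem : ∀ t, u t ∈ D) (hu : ∀ t, FollowsAt A B u t) : IsCrossingSolution D Xp Xm u := by
  have hXm : ∀ t, (u t).2 ≤ 0 → Xm t (u t) = A (u t) := fun t ht => hA t ⟨hmem t, ht⟩
  have hXp : ∀ t, 0 ≤ (u t).2 → Xp t (u t) = B (u t) := fun t ht => hB t ⟨hmem t, ht⟩
  refine ⟨hmem, fun t ht => ?_, fun t ht => ?_, fun t ht => ?_, fun t ht hpos => ?_,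
    fun t ht hneg => ?_⟩
  · rw [hXp t ht.le]
    rcases hu t with ⟨_, _⟩ | ⟨_, h⟩ | ⟨_⟩ | ⟨_⟩ <;> first | exact h | linarith
  · rw [hXm t ht.le]
    rcases hu t with ⟨_, h⟩ | ⟨_, _⟩ | ⟨_⟩ | ⟨_⟩ <;> first | exact h | linarith
  · rw [hXp t ht.ge, hXm t ht.le]
    rcases hu t with ⟨_, _⟩ | ⟨_, _⟩ | ⟨_, ha, hb⟩ | ⟨_, ha, hb⟩
    exacts [by linarith, by linarith, mul_pos_of_neg_of_neg hb ha, mul_pos hb ha]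
  · rw [hXp t ht.ge] at hpos ⊢
    rw [hXm t ht.le]
    rcases hu t with ⟨_, _⟩ | ⟨_, _⟩ | ⟨_⟩ | ⟨_, _, _, hl, hr⟩ <;>
      first | exact ⟨hl, hr⟩ | linarith
  · rw [hXp t ht.ge] at hneg ⊢
    rw [hXm t ht.le]
    rcases hu t with ⟨_, _⟩ | ⟨_, _⟩ | ⟨_, _, _, hl, hr⟩ | ⟨_⟩ <;>
      first | exact ⟨hl, hr⟩ | linarith

theorem exists_periodic_eqOn {α : Type*} {f g : ℝ → α} {a T : ℝ} (ha : 0 ≤ a) (haT : a < T)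
    (hfg : f a = g a) (hgf : g T = f 0) :
    ∃ u, Function.Periodic u T ∧ EqOn u f (Icc 0 a) ∧ EqOn u g (Icc a T) := by
  have hT : 0 < T := ha.trans_lt haT
  set v : ℝ → α := fun t => if t ≤ a then f t else g t
  have hmod : ∀ t ∈ Ico 0 T, toIcoMod hT 0 t = t := fun t ht =>
    (toIcoMod_eq_self hT).2 (by simpa using ht)
  refine ⟨fun t => v (toIcoMod hT 0 t), fun t => by simp, fun t ht => ?_, fun t ht => ?_⟩
  · simp [hmod t ⟨ht.1, ht.2.trans_lt haT⟩, v, ht.2]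
  · rcases ht.2.eq_or_lt with rfl | htT
    · have hmodT : toIcoMod hT 0 t = 0 := by simpa using toIcoMod_apply_right hT 0
      simp [hmodT, v, ha, hgf]
    rcases ht.1.eq_or_lt with rfl | hat
    · simp [hmod a ⟨ha, haT⟩, v, hfg]
    · simp [hmod t ⟨ha.trans ht.1, htT⟩, v, hat.not_ge]

theorem followsAt_of_isSolOn {a : ℝ} (ha : 0 < a) (haT : a < T) (hper : Function.Periodic u T)
    (hA : IsSolOn A D (Icc 0 a) u) (hB : IsSolOn B D (Icc a T) u)
    (hneg : ∀ t ∈ Ioo 0 a, (u t).2 < 0) (hpos : ∀ t ∈ Ioo a T, 0 < (u t).2)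
    (h0 : (u 0).2 = 0) (ha0 : (u a).2 = 0) (hA0 : (A (u 0)).2 < 0) (hB0 : (B (u 0)).2 < 0)
    (hAa : 0 < (A (u a)).2) (hBa : 0 < (B (u a)).2) (t : ℝ) : FollowsAt A B u t := by
  have hT : 0 < T := ha.trans haT
  obtain ⟨r, hr, hrt⟩ := (FollowsAt.periodic (A := A) (B := B) hper).exists_mem_Ioc hT t 0
  rw [hrt]
  rw [zero_add] at hr
  have huT : u T = u 0 := by simpa using hper 0
  rcases lt_trichotomy r a with hra | rfl | hra
  · exact .lower (hneg r ⟨hr.1, hra⟩)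
      ((hA r ⟨hr.1.le, hra.le⟩).2.hasDerivAt (Icc_mem_nhds hr.1 hra))
  · exact .up ha0 hAa hBa
      ((hA r ⟨ha.le, le_rfl⟩).2.mono_of_mem_nhdsWithin (Icc_mem_nhdsLE ha))
      ((hB r ⟨le_rfl, haT.le⟩).2.mono_of_mem_nhdsWithin (Icc_mem_nhdsGE haT))
  rcases hr.2.eq_or_lt with rfl | hrT
  · refine .down (by rw [huT, h0]) (by rwa [huT]) (by rwa [huT])
      ((hB r ⟨haT.le, le_rfl⟩).2.mono_of_mem_nhdsWithin (Icc_mem_nhdsLE haT))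
      (hasDerivWithinAt_of_periodic hper (J' := Ici 0) (fun s hs => by simpa using hs) ?_)
    rw [sub_self, huT]
    exact (hA 0 ⟨le_rfl, ha.le⟩).2.mono_of_mem_nhdsWithin (Icc_mem_nhdsGE ha)
  · exact .upper (hpos r ⟨hra, hrT⟩)
      ((hB r ⟨hra.le, hrT.le⟩).2.hasDerivAt (Icc_mem_nhds hra hrT))

theorem exists_isCrossingPeriodicSolution {Xp Xm : ℝ → ℝ × ℝ → ℝ × ℝ}
    (hRD : MapsTo R D D) (hA : ∀ t, EqOn (Xm t) A (D ∩ Prod.snd ⁻¹' Iic 0))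
    (hB : ∀ t, EqOn (Xp t) B (D ∩ Prod.snd ⁻¹' Ici 0)) {x P T₁ T₂ : ℝ} {u₁ u₂ : ℝ → ℝ × ℝ}
    (h₁ : IsHalfOrbit A D x T₁ P u₁) (h₂ : IsHalfOrbit (reversed B) D x T₂ P u₂) :
    ∃ u, IsCrossingPeriodicSolution D Xp Xm u ∧ u 0 = (x, 0) := by
  have hT₁ := h₁.pos
  have hT₂ := h₂.pos
  obtain ⟨u, hper, hu₁, hu₂⟩ := exists_periodic_eqOn (f := u₁) (a := T₁) (T := T₁ + T₂)
    (g := fun t => R (u₂ (T₁ + T₂ - t))) hT₁.le (lt_add_of_pos_right T₁ hT₂)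
    (by simp [h₁.finish, h₂.finish, R]) (by simp [h₁.start, h₂.start, R])
  have hu0 : u 0 = (x, 0) := (hu₁ ⟨le_rfl, hT₁.le⟩).trans h₁.start
  have huT₁ : u T₁ = (P, 0) := (hu₁ ⟨hT₁.le, le_rfl⟩).trans h₁.finish
  have hsol₁ : IsSolOn A D (Icc 0 T₁) u := h₁.isSolOn.congr hu₁
  have hsol₂ : IsSolOn B D (Icc T₁ (T₁ + T₂)) u :=
    (h₂.isSolOn.of_reversed hRD fun t ht => ⟨by linarith [ht.2], by linarith [ht.1]⟩).congr hu₂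
  have hmem : ∀ t, u t ∈ D := fun t => by
    obtain ⟨r, ⟨hr0, hrT⟩, hr⟩ := hper.exists_mem_Ioc (add_pos hT₁ hT₂) t 0
    rw [hr]
    rcases le_total r T₁ with hrT₁ | hrT₁
    exacts [(hsol₁ r ⟨hr0.le, hrT₁⟩).1, (hsol₂ r ⟨hrT₁, by rwa [zero_add] at hrT⟩).1]
  refine ⟨u, ⟨isCrossingSolution_of_followsAt hA hB hmem <|
    followsAt_of_isSolOn hT₁ (lt_add_of_pos_right T₁ hT₂) hper hsol₁ hsol₂ (fun t ht => ?_)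
      (fun t ht => ?_) (by rw [hu0]) (by rw [huT₁]) ?_ ?_ ?_ ?_,
    ⟨T₁ + T₂, add_pos hT₁ hT₂, hper⟩, 0, by rw [hu0]⟩, hu0⟩
  · rw [hu₁ (Ioo_subset_Icc_self ht)]
    exact h₁.neg t ht
  · rw [hu₂ (Ioo_subset_Icc_self ht)]
    exact neg_pos.2 (h₂.neg _ ⟨by linarith [ht.2], by linarith [ht.1]⟩)
  · simpa [hu0] using h₁.snd_start_neg
  · simpa [hu0, reversed_snd_of_snd_eq_zero] using h₂.snd_start_neg
  · simpa [huT₁] using h₁.snd_finish_pos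
  · simpa [huT₁, reversed_snd_of_snd_eq_zero] using h₂.snd_finish_pos

end Gluing

section SimpleZero

variable {d : ℝ × ℝ → ℝ} {x₀ : ℝ}

theorem exists_eventually_abs_sub_mul_deriv_le (hd : ContDiffAt ℝ 2 d (x₀, 0))
    (h0 : ∀ᶠ x in 𝓝 x₀, d (x, 0) = 0) :
    ∃ K : ℝ≥0, ∀ᶠ q in 𝓝 (x₀, 0),
      |d q - q.2 * deriv (fun ε => d (q.1, ε)) 0| ≤ K * q.2 ^ 2 := by
  obtain ⟨K, U, hU, hK⟩ := (hd.fderiv_right (m := 1) (by norm_num)).exists_lipschitzOnWith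
  obtain ⟨r, hr, hball⟩ := Metric.eventually_nhds_iff_ball.1
    ((hd.eventually (by simp)).and ((eventually_mem_set.2 hU).and (h0.prod_inl_nhds 0)))
  refine ⟨K, Metric.eventually_nhds_iff_ball.2 ⟨r, hr, fun ⟨x, ε⟩ hq => ?_⟩⟩
  obtain ⟨hx, hε⟩ : |x - x₀| < r ∧ |ε| < r := by
    simpa [Prod.dist_eq, Real.dist_eq] using hq
  have hmem : ∀ t, |t| ≤ |ε| → (x, t) ∈ ball (x₀, (0 : ℝ)) r := fun t ht => by
    simpa [Prod.dist_eq, Real.dist_eq] using And.intro hx (ht.trans_lt hε)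
  have hderiv : ∀ t, |t| ≤ |ε| → HasDerivAt (fun s => d (x, s)) (fderiv ℝ d (x, t) (0, 1)) t :=
    fun t ht => hasDerivAt_prodMk_right ((hball _ (hmem t ht)).1.differentiableAt two_ne_zero)
  have h0ε : |(0 : ℝ)| ≤ |ε| := by simp
  have hlip : ∀ t, |t| ≤ |ε| →
      ‖fderiv ℝ d (x, t) (0, 1) - fderiv ℝ d (x, 0) (0, 1)‖ ≤ K * |ε| := fun t ht => by
    have h := hK.norm_sub_le (hball _ (hmem t ht)).2.1 (hball _ (hmem 0 h0ε)).2.1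
    calc _ ≤ ‖fderiv ℝ d (x, t) - fderiv ℝ d (x, 0)‖ * ‖((0 : ℝ), (1 : ℝ))‖ :=
          (fderiv ℝ d (x, t) - fderiv ℝ d (x, 0)).le_opNorm _
      _ = ‖fderiv ℝ d (x, t) - fderiv ℝ d (x, 0)‖ := by simp [Prod.norm_def]
      _ ≤ K * |t| := by simpa [Prod.norm_def] using h
      _ ≤ K * |ε| := by gcongr
  have hmv := (convex_closedBall (0 : ℝ) |ε|).norm_image_sub_le_of_norm_hasDerivWithin_le
    (f := fun t => d (x, t) - t * fderiv ℝ d (x, 0) (0, 1)) (x := 0) (y := ε)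
    (fun t ht => by
      simpa using ((hderiv t (by simpa using ht)).fun_sub
        ((hasDerivAt_id t).mul_const (fderiv ℝ d (x, 0) (0, 1)))).hasDerivWithinAt)
    (fun t ht => hlip t (by simpa using ht)) (by simp) (by simp)
  have hx0 : d (x, 0) = 0 := (hball _ (hmem 0 h0ε)).2.2
  rw [(hderiv 0 h0ε).deriv]
  simpa [hx0, mul_assoc, ← sq] using hmv

theorem eventually_forall_abs_sub_le {p : ℝ × ℝ → Prop} (hp : ∀ᶠ q in 𝓝 (x₀, 0), p q) (C : ℝ) :
    ∀ᶠ ε in 𝓝[>] 0, ∀ x, |x - x₀| ≤ C * ε → p (x, ε) := by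
  obtain ⟨r, hr, hball⟩ := Metric.eventually_nhds_iff_ball.1 hp
  have hC : Tendsto (fun ε : ℝ => C * ε) (𝓝[>] 0) (𝓝 0) :=
    (Continuous.tendsto' (by fun_prop) _ _ (mul_zero C)).mono_left nhdsWithin_le_nhds
  filter_upwards [hC.eventually_lt_const hr, nhdsWithin_le_nhds (ball_mem_nhds (0 : ℝ) hr)]
    with ε hCε hε x hx
  exact hball _ (by
    simpa [Prod.dist_eq, Real.dist_eq] using And.intro (hx.trans_lt hCε) (by simpa using hε))

theorem exists_eventually_zero_of_deriv_pos (hd : ContDiffAt ℝ 2 d (x₀, 0))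
    (h0 : ∀ᶠ x in 𝓝 x₀, d (x, 0) = 0) (he0 : deriv (fun ε => d (x₀, ε)) 0 = 0) {a : ℝ}
    (he : HasDerivAt (fun x => deriv (fun ε => d (x, ε)) 0) a x₀) (ha : 0 < a) :
    ∃ C > 0, ∀ᶠ ε in 𝓝[>] 0, ∃ x, |x - x₀| ≤ C * ε ∧ d (x, ε) = 0 := by
  obtain ⟨K, hK⟩ := exists_eventually_abs_sub_mul_deriv_le hd h0
  have hlin : ∀ᶠ x in 𝓝 x₀, |deriv (fun ε => d (x, ε)) 0 - (x - x₀) * a| ≤ a / 2 * |x - x₀| := by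
    simpa [he0] using (hasDerivAt_iff_isLittleO.1 he).def (half_pos ha)
  set C : ℝ := 2 * (K + 1) / a with hC
  have hC0 : 0 < C := by positivity
  have hCa : a * C = 2 * (K + 1) := by rw [hC]; field_simp
  refine ⟨C, hC0, ?_⟩
  filter_upwards [self_mem_nhdsWithin, eventually_forall_abs_sub_le hK C,
    eventually_forall_abs_sub_le (hlin.prod_inl_nhds 0) C,
    eventually_forall_abs_sub_le ((hd.eventually (by simp)).mono fun _ h => h.continuousAt) C]
    with ε (hε : 0 < ε) hquad hlin hcont
  have hCε : 0 < C * ε := mul_pos hC0 hε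
  have hleft : d (x₀ - C * ε, ε) ≤ 0 := by
    have hx : |x₀ - C * ε - x₀| = C * ε := by simp [abs_of_pos hCε]
    have h₁ := (abs_le.1 (hquad _ hx.le)).2
    have h₂ := (abs_le.1 (hlin _ hx.le)).2
    rw [hx] at h₂
    nlinarith [mul_le_mul_of_nonneg_left h₂ hε.le, sq_nonneg ε]
  have hright : 0 ≤ d (x₀ + C * ε, ε) := by
    have hx : |x₀ + C * ε - x₀| = C * ε := by simp [abs_of_pos hCε]
    have h₁ := (abs_le.1 (hquad _ hx.le)).1
    have h₂ := (abs_le.1 (hlin _ hx.le)).1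
    rw [hx] at h₂
    nlinarith [mul_le_mul_of_nonneg_left h₂ hε.le, sq_nonneg ε]
  have hIcc : ∀ x ∈ Icc (x₀ - C * ε) (x₀ + C * ε), |x - x₀| ≤ C * ε := fun x hx =>
    abs_le.2 ⟨by linarith [hx.1], by linarith [hx.2]⟩
  have hcontOn : ContinuousOn (fun x => d (x, ε)) (Icc (x₀ - C * ε) (x₀ + C * ε)) := fun x hx =>
    ((hcont x (hIcc x hx)).comp (f := fun x => (x, ε)) (by fun_prop)).continuousWithinAt
  obtain ⟨x, hx, hx0⟩ := intermediate_value_Icc (by linarith) hcontOn ⟨hleft, hright⟩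
  exact ⟨x, hIcc x hx, hx0⟩

theorem differentiableAt_deriv_right (hd : ContDiffAt ℝ 2 d (x₀, 0)) :
    DifferentiableAt ℝ (fun x => deriv (fun ε => d (x, ε)) 0) x₀ := by
  have hd' : DifferentiableAt ℝ (fun x : ℝ => fderiv ℝ d (x, 0)) x₀ :=
    ((hd.fderiv_right (m := 1) (by norm_num)).differentiableAt one_ne_zero).comp
      (f := fun x : ℝ => (x, (0 : ℝ))) x₀ (by fun_prop)
  refine (hd'.clm_apply (differentiableAt_const ((0 : ℝ), (1 : ℝ)))).congr_of_eventuallyEq ?_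
  have hx : Tendsto (fun x : ℝ => (x, (0 : ℝ))) (𝓝 x₀) (𝓝 (x₀, 0)) :=
    Continuous.tendsto' (by fun_prop) _ _ rfl
  filter_upwards [hx.eventually (hd.eventually (by simp))] with x hdx
  exact (hasDerivAt_prodMk_right (hdx.differentiableAt two_ne_zero)).deriv

theorem exists_eventually_zero_of_deriv_ne_zero (hd : ContDiffAt ℝ 2 d (x₀, 0))
    (h0 : ∀ᶠ x in 𝓝 x₀, d (x, 0) = 0) (he0 : deriv (fun ε => d (x₀, ε)) 0 = 0)
    (he : deriv (fun x => deriv (fun ε => d (x, ε)) 0) x₀ ≠ 0) :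
    ∃ C > 0, ∀ᶠ ε in 𝓝[>] 0, ∃ x, |x - x₀| ≤ C * ε ∧ d (x, ε) = 0 := by
  have hderiv := (differentiableAt_deriv_right hd).hasDerivAt
  rcases he.lt_or_gt with hneg | hpos
  · simpa using exists_eventually_zero_of_deriv_pos (d := fun q => -d q) hd.neg
      (by simpa using h0) (by simpa using he0) (by simpa using hderiv.fun_neg) (neg_pos.2 hneg)
  · exact exists_eventually_zero_of_deriv_pos hd h0 he0 hderiv hpos

end SimpleZero

section Bifurcation

variable {F : ℝ × ℝ → ℝ × ℝ} {D : Set (ℝ × ℝ)} {X X₁ X₂ : (ℝ × ℝ) × ℝ → ℝ × ℝ} {x₀ : ℝ}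
  {n : WithTop ℕ∞} {T P T₁ P₁ T₂ P₂ : ℝ × ℝ → ℝ}

/-- The Melnikov function at `x` of a perturbation `g` of `F` along the half-orbit from `(x, 0)`;
`melnikov F D Gm Gp θ` is the one of `g = {Gm, Gp}_θ`. -/
noncomputable def halfMelnikov (F : ℝ × ℝ → ℝ × ℝ) (D : Set (ℝ × ℝ)) (g : ℝ → ℝ × ℝ → ℝ × ℝ)
    (x : ℝ) : ℝ :=
  wedge (F (flow F D (returnTime F D x) (x, 0))) (flowVariation F D g (returnTime F D x) (x, 0))

theorem halfMelnikov_bracket (Gm Gp : ℝ → ℝ × ℝ → ℝ × ℝ) (θ : ℝ) :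
    halfMelnikov F D (bracket Gm Gp θ) = melnikov F D Gm Gp θ := rfl

theorem IsHalfOrbit.halfMelnikov_congr {x s y : ℝ} {u : ℝ → ℝ × ℝ} {g₁ g₂ : ℝ → ℝ × ℝ → ℝ × ℝ}
    (h : IsHalfOrbit F D x s y u) (hD : IsOpen D) (hF : ContDiffOn ℝ 1 F D)
    (hg : ∀ t, ∀ z ∈ D, z.2 ≤ 0 → g₁ t z = g₂ t z) :
    halfMelnikov F D g₁ x = halfMelnikov F D g₂ x := by
  rw [halfMelnikov, halfMelnikov, (h.reachesAt hD hF).returnTime_eq, flowVariation, flowVariation]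
  congr 2
  refine intervalIntegral.integral_congr fun t ht => ?_
  rw [uIcc_of_le h.pos.le] at ht
  simp only [h.flow_eq hD hF ht, hg t _ (h.isSolOn t ht).1 (h.snd_nonpos t ht)]

theorem wedge_sub_right (a b c : ℝ × ℝ) : wedge a (b - c) = wedge a b - wedge a c := by
  simp only [wedge, Prod.fst_sub, Prod.snd_sub]
  ring

theorem flowVariation_sub {g₁ g₂ : ℝ → ℝ × ℝ → ℝ × ℝ} {s : ℝ} {z : ℝ × ℝ}
    (h₁ : IntervalIntegrable (fun t => (fundamental F D t z).inverse (g₁ t (flow F D t z)))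
      MeasureTheory.volume 0 s)
    (h₂ : IntervalIntegrable (fun t => (fundamental F D t z).inverse (g₂ t (flow F D t z)))
      MeasureTheory.volume 0 s) :
    flowVariation F D (fun t w => g₁ t w - g₂ t w) s z =
      flowVariation F D g₁ s z - flowVariation F D g₂ s z := by
  simp only [flowVariation, map_sub]
  rw [intervalIntegral.integral_sub h₁ h₂, map_sub]

namespace IsHalfReturn

theorem eventually_eq_flow (h : IsHalfReturn n X D x₀ T P) (hD : IsOpen D)
    (hF : ContDiffOn ℝ 1 F D) (hX : (fun z => X (z, 0)) = F) :
    ∀ᶠ x in 𝓝 x₀, T (x, 0) = returnTime F D x ∧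
      (P (x, 0), 0) = flow F D (returnTime F D x) (x, 0) := by
  have hx : Tendsto (fun x : ℝ => (x, (0 : ℝ))) (𝓝 x₀) (𝓝 (x₀, 0)) :=
    Continuous.tendsto' (by fun_prop) _ _ rfl
  filter_upwards [hx.eventually h.eventually_isHalfOrbit] with x ⟨u, hu⟩
  simp only [hX] at hu
  rw [(hu.reachesAt hD hF).returnTime_eq, hu.flow_eq hD hF ⟨hu.pos.le, le_rfl⟩]
  exact ⟨rfl, hu.finish.symm⟩

theorem eventually_sub_eq_zero (h₁ : IsHalfReturn n X₁ D x₀ T₁ P₁)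
    (h₂ : IsHalfReturn n X₂ D x₀ T₂ P₂) (hD : IsOpen D) (hF : ContDiffOn ℝ 1 F D)
    (hX₁ : (fun z => X₁ (z, 0)) = F) (hX₂ : (fun z => X₂ (z, 0)) = F) :
    ∀ᶠ x in 𝓝 x₀, P₁ (x, 0) - P₂ (x, 0) = 0 := by
  filter_upwards [h₁.eventually_eq_flow hD hF hX₁, h₂.eventually_eq_flow hD hF hX₂]
    with x ⟨_, hP₁⟩ ⟨_, hP₂⟩
  exact sub_eq_zero.2 (congrArg Prod.fst (hP₁.trans hP₂.symm))

theorem eventually_deriv_sub_mul_eq (h₁ : IsHalfReturn n X₁ D x₀ T₁ P₁)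
    (h₂ : IsHalfReturn n X₂ D x₀ T₂ P₂) (hn : n ≠ 0) (hn' : n ≠ ∞) (hD : IsOpen D)
    (hF : ContDiffOn ℝ 1 F D) (hX₁ : (fun z => X₁ (z, 0)) = F) (hX₂ : (fun z => X₂ (z, 0)) = F) :
    ∀ᶠ x in 𝓝 x₀, deriv (fun ε => P₁ (x, ε) - P₂ (x, ε)) 0 * (F (P₁ (x, 0), 0)).2 =
      -halfMelnikov F D (fun _ z => fderiv ℝ X₁ (z, 0) (0, 1) - fderiv ℝ X₂ (z, 0) (0, 1)) x := by
  have hx : Tendsto (fun x : ℝ => (x, (0 : ℝ))) (𝓝 x₀) (𝓝 (x₀, 0)) :=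
    Continuous.tendsto' (by fun_prop) _ _ rfl
  have hX₁' : ∀ z, X₁ (z, 0) = F z := congrFun hX₁
  have hX₂' : ∀ z, X₂ (z, 0) = F z := congrFun hX₂
  have hdiff : ∀ {P : ℝ × ℝ → ℝ}, ContDiffAt ℝ n P (x₀, 0) →
      ∀ᶠ x in 𝓝 x₀, DifferentiableAt ℝ (fun ε => P (x, ε)) 0 := fun hP => by
    filter_upwards [hx.eventually (hP.eventually hn')] with x hPx
    exact (hasDerivAt_prodMk_right (hPx.differentiableAt hn)).differentiableAt
  filter_upwards [h₁.eventually_eq_flow hD hF hX₁, h₂.eventually_eq_flow hD hF hX₂,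
    h₁.eventually_intervalIntegrable, h₂.eventually_intervalIntegrable,
    h₁.eventually_deriv_mul_eq, h₂.eventually_deriv_mul_eq, hdiff h₁.contDiffAt,
    hdiff h₂.contDiffAt] with x ⟨hT₁, hP₁⟩ ⟨hT₂, hP₂⟩ hi₁ hi₂ hd₁ hd₂ hdiff₁ hdiff₂
  simp only [hX₁', hX₂', hT₁, hT₂, hP₁, hP₂] at hi₁ hi₂ hd₁ hd₂ ⊢
  rw [deriv_fun_sub hdiff₁ hdiff₂, sub_mul, hd₁, hd₂, halfMelnikov, flowVariation_sub hi₁ hi₂,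
    wedge_sub_right]
  ring

theorem mem_and_snd_field_pos (h : IsHalfReturn n X D x₀ T P) (hX : (fun z => X (z, 0)) = F) :
    (P (x₀, 0), 0) ∈ D ∧ 0 < (F (P (x₀, 0), 0)).2 := by
  obtain ⟨u, hu⟩ := h.eventually_isHalfOrbit.self_of_nhds
  rw [hX] at hu
  exact ⟨hu.finish ▸ (hu.isSolOn _ ⟨hu.pos.le, le_rfl⟩).1, hu.snd_finish_pos⟩

end IsHalfReturn

theorem exists_eventually_common_isHalfOrbit (h₁ : IsHalfReturn 2 X₁ D x₀ T₁ P₁)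
    (h₂ : IsHalfReturn 2 X₂ D x₀ T₂ P₂) (hD : IsOpen D) (hF : ContDiffOn ℝ 1 F D)
    (hX₁ : (fun z => X₁ (z, 0)) = F) (hX₂ : (fun z => X₂ (z, 0)) = F) {M : ℝ → ℝ}
    (hM : M =ᶠ[𝓝 x₀] halfMelnikov F D fun _ z =>
      fderiv ℝ X₁ (z, 0) (0, 1) - fderiv ℝ X₂ (z, 0) (0, 1))
    (hM0 : M x₀ = 0) (hM' : deriv M x₀ ≠ 0) :
    ∃ C > 0, ∀ᶠ ε in 𝓝[>] 0, ∃ x, |x - x₀| ≤ C * ε ∧ ∃ s₁ s₂ y u₁ u₂,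
      IsHalfOrbit (fun z => X₁ (z, ε)) D x s₁ y u₁ ∧
      IsHalfOrbit (fun z => X₂ (z, ε)) D x s₂ y u₂ := by
  set e : ℝ → ℝ := fun x => deriv (fun ε => P₁ (x, ε) - P₂ (x, ε)) 0
  set b : ℝ → ℝ := fun x => (F (P₁ (x, 0), 0)).2
  have hd : ContDiffAt ℝ 2 (fun q => P₁ q - P₂ q) (x₀, 0) := h₁.contDiffAt.sub h₂.contDiffAt
  have hMe : ∀ᶠ x in 𝓝 x₀, M x = -(e x * b x) := by
    filter_upwards [hM, h₁.eventually_deriv_sub_mul_eq h₂ two_ne_zero (by simp) hD hF hX₁ hX₂]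
      with x hMx hx
    rw [hMx, hx, neg_neg]
  obtain ⟨hmem, hbpos⟩ := h₁.mem_and_snd_field_pos hX₁
  have he0 : e x₀ = 0 := by
    have h := hMe.self_of_nhds
    rw [hM0, zero_eq_neg, mul_eq_zero] at h
    exact h.resolve_right hbpos.ne'
  have hb : DifferentiableAt ℝ b x₀ :=
    (((hF.contDiffAt (hD.mem_nhds hmem)).differentiableAt one_ne_zero).comp
      (f := fun x : ℝ => (P₁ (x, 0), (0 : ℝ))) x₀
      (((h₁.contDiffAt.differentiableAt two_ne_zero).comp (f := fun x : ℝ => (x, (0 : ℝ))) x₀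
        (by fun_prop)).prodMk (differentiableAt_const 0))).snd
  have he' : deriv e x₀ ≠ 0 := fun he' => hM' <| by
    have h := ((differentiableAt_deriv_right hd).hasDerivAt.fun_mul hb.hasDerivAt).fun_neg
    rw [(h.congr_of_eventuallyEq hMe).deriv]
    simp [e, he', he0]
  obtain ⟨C, hC, hzero⟩ := exists_eventually_zero_of_deriv_ne_zero hd
    (h₁.eventually_sub_eq_zero h₂ hD hF hX₁ hX₂) he0 he'
  refine ⟨C, hC, ?_⟩
  filter_upwards [hzero, eventually_forall_abs_sub_le h₁.eventually_isHalfOrbit C,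
    eventually_forall_abs_sub_le h₂.eventually_isHalfOrbit C] with ε ⟨x, hx, hPx⟩ ho₁ ho₂
  obtain ⟨u₁, hu₁⟩ := ho₁ x hx
  obtain ⟨u₂, hu₂⟩ := ho₂ x hx
  exact ⟨x, hx, _, _, _, u₁, u₂, hu₁, sub_eq_zero.1 hPx ▸ hu₂⟩

end Bifurcation

section Perturbed

variable {D : Set (ℝ × ℝ)} {F : ℝ × ℝ → ℝ × ℝ} {G Gm Gp : ℝ → ℝ × ℝ → ℝ × ℝ}
  {H Hm Hp : ℝ → ℝ × ℝ → ℝ → ℝ × ℝ} {I : Set ℝ} {n : WithTop ℕ∞}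

theorem eqOn_inter_preimage_closure {E : Type*} [TopologicalSpace E] [T2Space E] (hD : IsOpen D)
    {f g : ℝ × ℝ → E} (hf : ContinuousOn f D) (hg : ContinuousOn g D) {S : Set ℝ}
    (h : EqOn f g (D ∩ Prod.snd ⁻¹' S)) : EqOn f g (D ∩ Prod.snd ⁻¹' closure S) := by
  refine h.of_subset_closure (hf.mono inter_subset_left) (hg.mono inter_subset_left)
    (inter_subset_inter_right D (preimage_mono subset_closure)) ?_
  rw [isOpenMap_snd.preimage_closure_eq_closure_preimage continuous_snd]
  exact hD.inter_closure

theorem reversed_reversed (F : ℝ × ℝ → ℝ × ℝ) : reversed (reversed F) = F := by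
  ext z <;> simp [reversed, R]

theorem reversed_perturbed (F : ℝ × ℝ → ℝ × ℝ) (G : ℝ → ℝ × ℝ → ℝ × ℝ)
    (H : ℝ → ℝ × ℝ → ℝ → ℝ × ℝ) (ε t : ℝ) :
    reversed (perturbed F G H ε t) =
      perturbed (reversed F) (fun s => reversed (G s))
        (fun s z δ => reversed (fun w => H s w δ) z) ε t := by
  ext z
  · simp [reversed, perturbed, R]
    ring
  · simp [reversed, perturbed, R]

theorem bracket_eq_sub_reversed (Gm Gp : ℝ → ℝ × ℝ → ℝ × ℝ) (θ t : ℝ) (z : ℝ × ℝ) :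
    bracket Gm Gp θ t z = Gm (t + θ) z - reversed (Gp (-t + θ)) z := by
  simp [bracket, reversed]

theorem perturbed_zero (t : ℝ) : perturbed F G H 0 t = F := by
  ext z <;> simp [perturbed]

theorem contDiffOn_perturbed (hF : ContDiffOn ℝ n F D)
    (hG : ContDiffOn ℝ n (fun p : ℝ × (ℝ × ℝ) => G p.1 p.2) (univ ×ˢ D))
    (hH : ContDiffOn ℝ n (fun p : ℝ × (ℝ × ℝ) × ℝ => H p.1 p.2.1 p.2.2) (univ ×ˢ D ×ˢ I)) (t : ℝ) :
    ContDiffOn ℝ n (fun p : (ℝ × ℝ) × ℝ => perturbed F G H p.2 t p.1) (D ×ˢ I) := by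
  have hF' : ContDiffOn ℝ n (fun p : (ℝ × ℝ) × ℝ => F p.1) (D ×ˢ I) :=
    hF.comp contDiff_fst.contDiffOn fun p hp => hp.1
  have hG' : ContDiffOn ℝ n (fun p : (ℝ × ℝ) × ℝ => G t p.1) (D ×ˢ I) :=
    hG.comp (f := fun p : (ℝ × ℝ) × ℝ => (t, p.1))
      (contDiff_const.prodMk contDiff_fst).contDiffOn fun p hp => ⟨trivial, hp.1⟩
  have hH' : ContDiffOn ℝ n (fun p : (ℝ × ℝ) × ℝ => H t p.1 p.2) (D ×ˢ I) :=
    hH.comp (f := fun p : (ℝ × ℝ) × ℝ => (t, p))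
      (contDiff_const.prodMk contDiff_id).contDiffOn fun p hp => ⟨trivial, hp⟩
  exact (hF'.add (contDiff_snd.contDiffOn.smul hG')).add
    ((contDiff_snd.pow 2).contDiffOn.smul hH')

theorem hasDerivAt_perturbed {t : ℝ} {z : ℝ × ℝ} (hH : DifferentiableAt ℝ (H t z) 0) :
    HasDerivAt (fun ε => perturbed F G H ε t z) (G t z) 0 := by
  have h₁ : HasDerivAt (fun ε : ℝ => ε • G t z) (G t z) 0 := by
    simpa using (hasDerivAt_id (0 : ℝ)).smul_const (G t z)
  have h₂ : HasDerivAt (fun ε : ℝ => ε ^ 2 • H t z ε) 0 0 := by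
    simpa using (hasDerivAt_pow 2 (0 : ℝ)).fun_smul hH.hasDerivAt
  simpa [perturbed] using ((hasDerivAt_const (0 : ℝ) (F z)).fun_add h₁).fun_add h₂

theorem contDiffOn_reversed (hRD : MapsTo R D D) (hF : ContDiffOn ℝ n F D) :
    ContDiffOn ℝ n (reversed F) D :=
  (reflection.contDiff.comp_contDiffOn (hF.comp reflection.contDiff.contDiffOn hRD)).neg

/-- `F + ε G + ε² H`, for `ε ∈ I`, is a `C²` family of fields on `D` that does not depend on time
in the zone `y ∈ S`; the two zones of a Filippov system are `S = Iio 0` and `S = Ioi 0`. -/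
structure IsZoneFamily (F : ℝ × ℝ → ℝ × ℝ) (D : Set (ℝ × ℝ)) (I S : Set ℝ)
    (G : ℝ → ℝ × ℝ → ℝ × ℝ) (H : ℝ → ℝ × ℝ → ℝ → ℝ × ℝ) : Prop where
  contDiffOn_field : ContDiffOn ℝ 2 F D
  contDiffOn_first : ContDiffOn ℝ 2 (fun p : ℝ × (ℝ × ℝ) => G p.1 p.2) (univ ×ˢ D)
  contDiffOn_second : ContDiffOn ℝ 2 (fun p : ℝ × (ℝ × ℝ) × ℝ => H p.1 p.2.1 p.2.2)
    (univ ×ˢ D ×ˢ I)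
  eqOn : ∀ ε ∈ I, ∀ s t,
    EqOn (perturbed F G H ε s) (perturbed F G H ε t) (D ∩ Prod.snd ⁻¹' S)

namespace IsZoneFamily

variable {S : Set ℝ}

protected theorem reversed (h : IsZoneFamily F D I (Ioi 0) G H) (hRD : MapsTo R D D) :
    IsZoneFamily (reversed F) D I (Iio 0) (fun s => reversed (G s))
      fun s z δ => reversed (fun w => H s w δ) z where
  contDiffOn_field := contDiffOn_reversed hRD h.contDiffOn_field
  contDiffOn_first := (reflection.contDiff.comp_contDiffOn <|
    h.contDiffOn_first.comp (f := fun p : ℝ × (ℝ × ℝ) => (p.1, reflection p.2))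
      (by fun_prop) fun _ hp => ⟨trivial, hRD hp.2⟩).neg
  contDiffOn_second := (reflection.contDiff.comp_contDiffOn <|
    h.contDiffOn_second.comp (f := fun p : ℝ × (ℝ × ℝ) × ℝ => (p.1, reflection p.2.1, p.2.2))
      (by fun_prop) fun _ hp => ⟨trivial, hRD hp.2.1, hp.2.2⟩).neg
  eqOn ε hε s t z hz := by
    simp only [← reversed_perturbed]
    exact congrArg (fun w => -R w) (h.eqOn ε hε s t ⟨hRD hz.1, by simpa [R] using hz.2⟩)

theorem contDiffOn (h : IsZoneFamily F D I S G H) (t : ℝ) :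
    ContDiffOn ℝ 2 (fun p : (ℝ × ℝ) × ℝ => perturbed F G H p.2 t p.1) (D ×ˢ I) :=
  contDiffOn_perturbed h.contDiffOn_field h.contDiffOn_first h.contDiffOn_second t

theorem differentiableAt_second (h : IsZoneFamily F D I S G H) (hD : IsOpen D) (hI : I ∈ 𝓝 0)
    (t : ℝ) {z : ℝ × ℝ} (hz : z ∈ D) : DifferentiableAt ℝ (H t z) 0 :=
  ((h.contDiffOn_second.contDiffAt (prod_mem_nhds univ_mem
    (prod_mem_nhds (hD.mem_nhds hz) hI))).differentiableAt two_ne_zero).comp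
      (f := fun ε : ℝ => (t, z, ε)) (0 : ℝ) (by fun_prop)

theorem fderiv_apply_snd (h : IsZoneFamily F D I S G H) (hD : IsOpen D) (hI : I ∈ 𝓝 0)
    (t : ℝ) {z : ℝ × ℝ} (hz : z ∈ D) :
    fderiv ℝ (fun p : (ℝ × ℝ) × ℝ => perturbed F G H p.2 t p.1) (z, 0) (0, 1) = G t z :=
  (hasDerivAt_prodMk_right (((h.contDiffOn t).contDiffAt
    (prod_mem_nhds (hD.mem_nhds hz) hI)).differentiableAt two_ne_zero)).unique
      (hasDerivAt_perturbed (h.differentiableAt_second hD hI t hz))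

theorem eqOn_closure (h : IsZoneFamily F D I S G H) (hD : IsOpen D) {ε : ℝ} (hε : ε ∈ I)
    (s t : ℝ) :
    EqOn (perturbed F G H ε s) (perturbed F G H ε t) (D ∩ Prod.snd ⁻¹' closure S) := by
  have hcont : ∀ t, ContinuousOn (perturbed F G H ε t) D := fun t =>
    (h.contDiffOn t).continuousOn.comp (f := fun z => (z, ε)) (by fun_prop) fun _ hz => ⟨hz, hε⟩
  exact eqOn_inter_preimage_closure hD (hcont s) (hcont t) (h.eqOn ε hε s t)

theorem first_eqOn_closure (h : IsZoneFamily F D I S G H) (hD : IsOpen D) (hI : I ∈ 𝓝 0)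
    (s t : ℝ) : EqOn (G s) (G t) (D ∩ Prod.snd ⁻¹' closure S) := fun z hz => by
  refine (hasDerivAt_perturbed (F := F) (h.differentiableAt_second hD hI s hz.1)).unique
    ((hasDerivAt_perturbed (F := F) (h.differentiableAt_second hD hI t hz.1)).congr_of_eventuallyEq
      ?_)
  filter_upwards [hI] with ε hε
  exact h.eqOn_closure hD hε s t hz

theorem exists_isHalfReturn (h : IsZoneFamily F D I S G H) (hD : IsOpen D) (hI : I ∈ 𝓝 0)
    {x s y : ℝ} {u : ℝ → ℝ × ℝ} (hu : IsHalfOrbit F D x s y u) (t : ℝ) :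
    ∃ T P, IsHalfReturn 2 (fun p : (ℝ × ℝ) × ℝ => perturbed F G H p.2 t p.1) D x T P := by
  rw [← perturbed_zero (F := F) (G := G) (H := H) t] at hu
  exact TwoFold.exists_isHalfReturn (n := 2) two_ne_zero hD hI (h.contDiffOn t) hu

theorem eventually_halfMelnikov_eq (hm : IsZoneFamily F D I (Iio 0) Gm Hm)
    (hp : IsZoneFamily F D I (Iio 0) Gp Hp) (hD : IsOpen D) (hI : I ∈ 𝓝 0) {x₀ : ℝ}
    (horb : ∀ᶠ x in 𝓝 x₀, ∃ s y u, IsHalfOrbit F D x s y u) (θ : ℝ) :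
    halfMelnikov F D (fun t z => Gm (t + θ) z - Gp (-t + θ) z) =ᶠ[𝓝 x₀]
      halfMelnikov F D fun _ z =>
        fderiv ℝ (fun p : (ℝ × ℝ) × ℝ => perturbed F Gm Hm p.2 0 p.1) (z, 0) (0, 1) -
        fderiv ℝ (fun p : (ℝ × ℝ) × ℝ => perturbed F Gp Hp p.2 0 p.1) (z, 0) (0, 1) := by
  filter_upwards [horb] with x ⟨s, y, u, hu⟩
  refine hu.halfMelnikov_congr hD (hm.contDiffOn_field.of_le one_le_two) fun t z hz hz0 => ?_
  have hmem : z ∈ D ∩ Prod.snd ⁻¹' closure (Iio 0) := ⟨hz, by simpa using hz0⟩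
  rw [hm.fderiv_apply_snd hD hI 0 hz, hp.fderiv_apply_snd hD hI 0 hz,
    hm.first_eqOn_closure hD hI (t + θ) 0 hmem, hp.first_eqOn_closure hD hI (-t + θ) 0 hmem]

theorem exists_eventually_common_isHalfOrbit (hm : IsZoneFamily F D I (Iio 0) Gm Hm)
    (hp : IsZoneFamily F D I (Iio 0) Gp Hp) (hD : IsOpen D) (hI : I ∈ 𝓝 0) {x₀ s y : ℝ}
    {u : ℝ → ℝ × ℝ} (hu : IsHalfOrbit F D x₀ s y u) {θ : ℝ}
    (hM : halfMelnikov F D (fun t z => Gm (t + θ) z - Gp (-t + θ) z) x₀ = 0)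
    (hM' : deriv (halfMelnikov F D fun t z => Gm (t + θ) z - Gp (-t + θ) z) x₀ ≠ 0) :
    ∃ C > 0, ∀ᶠ ε in 𝓝[>] 0, ∃ x, |x - x₀| ≤ C * ε ∧ ∃ s₁ s₂ y u₁ u₂,
      IsHalfOrbit (perturbed F Gm Hm ε 0) D x s₁ y u₁ ∧
      IsHalfOrbit (perturbed F Gp Hp ε 0) D x s₂ y u₂ := by
  obtain ⟨T₁, P₁, h₁⟩ := hm.exists_isHalfReturn hD hI hu 0
  obtain ⟨T₂, P₂, h₂⟩ := hp.exists_isHalfReturn hD hI hu 0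
  have hx : Tendsto (fun x : ℝ => (x, (0 : ℝ))) (𝓝 x₀) (𝓝 (x₀, 0)) :=
    Continuous.tendsto' (by fun_prop) _ _ rfl
  have horb : ∀ᶠ x in 𝓝 x₀, ∃ s y u, IsHalfOrbit F D x s y u := by
    filter_upwards [hx.eventually h₁.eventually_isHalfOrbit] with x ⟨v, hv⟩
    exact ⟨_, _, v, perturbed_zero (F := F) (G := Gm) (H := Hm) 0 ▸ hv⟩
  exact TwoFold.exists_eventually_common_isHalfOrbit h₁ h₂ hD
    (hm.contDiffOn_field.of_le one_le_two) (perturbed_zero 0) (perturbed_zero 0)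
    (hm.eventually_halfMelnikov_eq hp hD hI horb θ) hM hM'

end IsZoneFamily

end Perturbed

end TwoFold

open TwoFold

theorem mainTheorem2_general {D : Set (ℝ × ℝ)} (hD : IsOpen D)
    (hRD : ∀ z ∈ D, R z ∈ D) {F : ℝ × ℝ → ℝ × ℝ} (hF : ContDiffOn ℝ 2 F D)
    {x₀ s : ℝ} (hne : (F (x₀, 0)).2 ≠ 0) (hs : ReachesAt F D x₀ s)
    {ε₀ : ℝ} (hε₀ : 0 < ε₀) {Gp Gm : ℝ → ℝ × ℝ → ℝ × ℝ} {Hp Hm : ℝ → ℝ × ℝ → ℝ → ℝ × ℝ}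
    (hGp : ContDiffOn ℝ 2 (fun p : ℝ × (ℝ × ℝ) => Gp p.1 p.2) (univ ×ˢ D))
    (hGm : ContDiffOn ℝ 2 (fun p : ℝ × (ℝ × ℝ) => Gm p.1 p.2) (univ ×ˢ D))
    (hHp : ContDiffOn ℝ 2 (fun p : ℝ × (ℝ × ℝ) × ℝ => Hp p.1 p.2.1 p.2.2)
      (univ ×ˢ D ×ˢ Ioo (-ε₀) ε₀))
    (hHm : ContDiffOn ℝ 2 (fun p : ℝ × (ℝ × ℝ) × ℝ => Hm p.1 p.2.1 p.2.2)
      (univ ×ˢ D ×ˢ Ioo (-ε₀) ε₀))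
    (hauto : ∀ ε ∈ Ioo (-ε₀) ε₀, IsAutonomous D
      (perturbed (reversed F) Gp Hp ε) (perturbed F Gm Hm ε))
    {θ : ℝ} (hM : melnikov F D Gm Gp θ x₀ = 0)
    (hM' : deriv (fun x => melnikov F D Gm Gp θ x) x₀ ≠ 0) :
    ∃ C : ℝ, 0 < C ∧ ∃ ε₁ ∈ Ioc 0 ε₀, ∀ ε ∈ Ioo 0 ε₁, ∃ u : ℝ → ℝ × ℝ,
      IsCrossingPeriodicSolution D
        (perturbed (reversed F) Gp Hp ε) (perturbed F Gm Hm ε) u ∧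
      ‖u 0 - (x₀, 0)‖ ≤ C * ε := by
  have hlower : IsZoneFamily F D (Ioo (-ε₀) ε₀) (Iio 0) Gm Hm :=
    ⟨hF, hGm, hHm, fun ε hε s t z hz => (hauto ε hε s t z hz.1).2 hz.2⟩
  have hupper : IsZoneFamily (reversed F) D (Ioo (-ε₀) ε₀) (Ioi 0) Gp Hp :=
    ⟨contDiffOn_reversed hRD hF, hGp, hHp, fun ε hε s t z hz => (hauto ε hε s t z hz.1).1 hz.2⟩
  have hreflected := hupper.reversed hRD
  rw [reversed_reversed] at hreflected
  have hI : Ioo (-ε₀) ε₀ ∈ 𝓝 0 := Ioo_mem_nhds (neg_neg_of_pos hε₀) hε₀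
  obtain ⟨y, u₀, hu₀⟩ := hs.exists_isHalfOrbit hD (hF.of_le one_le_two) hne
  have hmel : (halfMelnikov F D fun t z => Gm (t + θ) z - reversed (Gp (-t + θ)) z) =
      melnikov F D Gm Gp θ := by
    simp only [← bracket_eq_sub_reversed, ← halfMelnikov_bracket]
  obtain ⟨C, hC, hpair⟩ := hlower.exists_eventually_common_isHalfOrbit hreflected hD hI hu₀
    (θ := θ) (by rw [hmel, hM]) (by rwa [hmel])
  obtain ⟨ε₁, hε₁, hε₁ball⟩ := mem_nhdsGT_iff_exists_Ioo_subset' hε₀ |>.1 hpair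
  refine ⟨C, hC, min ε₁ ε₀, ⟨lt_min hε₁ hε₀, min_le_right _ _⟩, fun ε hε => ?_⟩
  obtain ⟨x, hx, T₁, T₂, y, u₁, u₂, hu₁, hu₂⟩ := hε₁ball ⟨hε.1, hε.2.trans_le (min_le_left _ _)⟩
  rw [← reversed_reversed F, ← reversed_perturbed] at hu₂
  have hεI : ε ∈ Ioo (-ε₀) ε₀ := ⟨by linarith [hε.1], hε.2.trans_le (min_le_right _ _)⟩
  obtain ⟨u, hu, hu0⟩ := exists_isCrossingPeriodicSolution hRD
    (fun t => closure_Iio (0 : ℝ) ▸ hlower.eqOn_closure hD hεI t 0)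
    (fun t => closure_Ioi (0 : ℝ) ▸ hupper.eqOn_closure hD hεI t 0) hu₁ hu₂
  exact ⟨u, hu, by simpa [hu0, Prod.norm_def] using hx⟩

theorem mainTheorem2
    (D : Set (ℝ × ℝ)) (hD : IsOpen D) (hRD : ∀ z ∈ D, TwoFold.R z ∈ D)
    (F : ℝ × ℝ → ℝ × ℝ) (hF : ContDiffOn ℝ 2 F D)
    (xi xv : ℝ) (h1 : TwoFold.FoldHyp F D xi xv) (h2 : TwoFold.ReturnHyp F D xi xv)
    (ε₀ : ℝ) (hε₀ : 0 < ε₀)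
    (Gp Gm : ℝ → ℝ × ℝ → ℝ × ℝ) (Hp Hm : ℝ → ℝ × ℝ → ℝ → ℝ × ℝ)
    (hGp : ContDiffOn ℝ ∞ (fun p : ℝ × (ℝ × ℝ) => Gp p.1 p.2) (univ ×ˢ D))
    (hGm : ContDiffOn ℝ ∞ (fun p : ℝ × (ℝ × ℝ) => Gm p.1 p.2) (univ ×ˢ D))
    (hHp : ContDiffOn ℝ ∞ (fun p : ℝ × (ℝ × ℝ) × ℝ => Hp p.1 p.2.1 p.2.2)
      (univ ×ˢ D ×ˢ Ioo (-ε₀) ε₀))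
    (hHm : ContDiffOn ℝ ∞ (fun p : ℝ × (ℝ × ℝ) × ℝ => Hm p.1 p.2.1 p.2.2)
      (univ ×ˢ D ×ˢ Ioo (-ε₀) ε₀))
    (hauto : ∀ ε ∈ Ioo (-ε₀) ε₀, TwoFold.IsAutonomous D
      (TwoFold.perturbed (TwoFold.reversed F) Gp Hp ε) (TwoFold.perturbed F Gm Hm ε))
    (θ xs : ℝ) (hxs : xs ∈ Ioo xi xv)
    (hM : TwoFold.melnikov F D Gm Gp θ xs = 0)
    (hM' : deriv (fun x => TwoFold.melnikov F D Gm Gp θ x) xs ≠ 0) :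
    ∃ C : ℝ, 0 < C ∧ ∃ ε₁ ∈ Ioc 0 ε₀, ∀ ε ∈ Ioo 0 ε₁, ∃ u : ℝ → ℝ × ℝ,
      TwoFold.IsCrossingPeriodicSolution D
        (TwoFold.perturbed (TwoFold.reversed F) Gp Hp ε) (TwoFold.perturbed F Gm Hm ε) u ∧
      ‖u 0 - (xs, 0)‖ ≤ C * ε := by
  obtain ⟨s, hs⟩ := h2 xs (Ioo_subset_Ioc_self hxs)
  have h : (2 : WithTop ℕ∞) ≤ ∞ := ENat.LEInfty.out
  exact mainTheorem2_general hD hRD hF (h1.ne_zero xs hxs) hs hε₀ (hGp.of_le h) (hGm.of_le h)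
    (hHp.of_le h) (hHm.of_le h) hauto hM hM'
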